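/- **Setting.** Let $\mathsf P=\{\mathtt p_1,\dots,\mathtt p_N\}$ be a finite set of processes, $\mathsf{Var}$ a non-empty set of shared variables and $\mathsf{Val}$ a set of values with a distinguished initial value $0$. Memory actions are writes $\mathtt W(x,v)$, reads $\mathtt R(x,v)$ (the value read is part of the action), read-modify-writes $\mathtt{RMW}(x,v_{\rm old},v_{\rm new})$ and fences $\mathtt F$; a memory event is a pair of a process and a memory action. A memory model is a labeled transition system (LTS) whose labels are the memory events and a silent internal step $\tau$. *TSO.* A state consists of a main memory $m:\mathsf{Var}\to\mathsf{Val}$ and a FIFO store buffer $b(p)\in(\mathsf{Var}\times\mathsf{Val})^*$ for every process; initially $m=\lambda x.\,0$ and all buffers are empty. A write of $p$ appends $\langle x,v\rangle$ to $b(p)$; a read of $x$ by $p$ returns the value of the last entry for $x$ in $b(p)$, or $m(x)$ if there is none; a fence or RMW of $p$ requires $b(p)$ to be empty (and an RMW then atomically checks $m(x)=v_{\rm old}$ and sets $m(x)=v_{\rm new}$); a silent step moves the oldest entry of some buffer to the main memory. *RA.* A state consists of a set of messages $\langle x,v,t,V\rangle$ ($t\in\mathbb N$ a timestamp, $V:\mathsf{Var}\to\mathbb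 N$ a view), a view $V_p$ for every process $p$ and a fence view $V_{\mathsf f}$; initially there is a message $\langle x,0,0,\lambda y.\,0\rangle$ for every $x$, and all views are $\lambda y.\,0$. A write of $v$ to $x$ by $p$ chooses a timestamp $t>V_p(x)$ that no message of $x$ has, sets $V_p(x):=t$ and adds the message $\langle x,v,t,V_p\rangle$ (with the updated $V_p$); a read of $x$ by $p$ returns the value of a message of $x$ with timestamp $V_p(x)$; an RMW reads in this way and writes with timestamp $V_p(x)+1$, which must be unused for $x$; a fence of $p$ sets both $V_p$ and $V_{\mathsf f}$ to the pointwise maximum $V_p\sqcup V_{\mathsf f}$; a silent step chooses a process $p$ and a message $\langle x,v,t,V\rangle$ with $V_p(x)<t$ and sets $V_p:=V_p\sqcup V$. *Objects.* An object is given by a prefix-closed set of complete sequential histories (sequences of invocations and responses, each tagged with a process). $\mathsf{Reg}$, for a set $A\subseteq\mathsf{Val}$, has operations $\mathtt{write}(a)$ ($a\in A$), which returns $\mathtt{ack}$, and $\mathtt{read}$, which returns the last value written, or $0$ if there is none. $\mathsf{MaxReg}$ has operations $\mathtt{write}(a)$ ($a\in\mathbb Z$), which returns $\mathtt{ack}$,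 and $\mathtt{read}$, which returns the maximum of $0$ and all values written so far. *Implementations.* An implementation assigns to every operation $o$ and process $p$ an LTS whose labels are events of $p$ and in which a response is always the last transition. The processes repeatedly invoke operations and run their LTSs, interleaved arbitrarily. The histories generated under a memory model $M$ are the sequences of invocations and responses of those finite traces of this system whose subsequence of memory events is a trace of $M$ with the silent steps erased. The implementation is *linearizable* under $M$ if for every such history one can append responses to some pending operations, drop the remaining pending invocations, and reorder the result to a history of the specification, preserving the order of the events of each process and the order of every response before an invocation. It is *wait-free* under $M$ if every operation terminates after finitely many steps of its own process, whatever the other processes do: in every infinite execution a process that takes infinitely many steps completes infinitely many operations; a process in the middle of an operation can always take a step, possibly after finitely many silent steps of the memory; and a process that reads a variable accepts every value. **Theorem.** Let $O$ be $\mathsf{Reg}$ (for any $A\subseteq\mathsf{Val}$) or $\mathsf{MaxReg}$; for $\mathsf{MaxReg}$ assume that there are at least $N$ shared variables, and that the memory can store integers, i.e. that there is an injection $\iota:\mathbb Z\to\mathsf{Val}$ with $\iota(0)=0$. 1. There is an implementation of $O$ that is linearizable and wait-free under TSO and uses only reads, writes and a single fence at the end of $\mathtt{write}$: every complete execution of $\mathtt{write}(a)$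 performs a sequence of reads and writes followed by one fence, every complete execution of $\mathtt{read}$ performs only reads and writes, and incomplete executions are prefixes of sequences of this form. 2. There is an implementation of $O$ that is linearizable and wait-free under RA and uses only reads, writes and one fence at the beginning and one fence at the end of both $\mathtt{write}$ and $\mathtt{read}$: every complete execution of an operation performs one fence, then a sequence of reads and writes, then one fence, and incomplete executions are prefixes of sequences of this form. 3. For $O=\mathsf{MaxReg}$, the following collect-based algorithm, over any array $M$ of $N$ distinct shared variables, has the properties in 2. Process $\mathtt p_i$ executes - $\mathtt{read}()$: fence; $m:=collect(M)$; fence; return $\max(m)$; - $\mathtt{write}(v)$: fence; $m:=collect(M)$; if $\max(m)<v$ then $M[i]:=v$; fence; return $\mathtt{ack}$, where $collect(M)$ reads the entries of $M$ one by one, in an arbitrary order, and returns the array of the values read (integers being stored through $\iota$). -/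

import Mathlib

namespace WMM

/-! ### Labeled transition systems -/

/-- A labeled transition system with labels in `L`. -/
structure LTS (L : Type) where
  State : Type
  start : State
  Tr : State → L → State → Prop

/-- `S.Run q π q'`: the sequence of labels `π` leads from `q` to `q'`. -/
inductive LTS.Run {L : Type} (S : LTS L) : S.State → List L → S.State → Prop
  | nil (q : S.State) : LTS.Run S q [] q
  | cons {q q' q'' : S.State} {l : L} {π : List L} :
      S.Tr q l q' → LTS.Run S q' π q'' → LTS.Run S q (l :: π) q''

/-- The finite traces from the initial state. -/
def LTS.traces {L : Type} (S : LTS L) : Set (List L) :=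
  {π | ∃ q, S.Run S.start π q}

/-- An infinite execution from the initial state. -/
def LTS.IsInfiniteRun {L : Type} (S : LTS L) (c : ℕ → S.State) (l : ℕ → L) : Prop :=
  c 0 = S.start ∧ ∀ n, S.Tr (c n) (l n) (c (n + 1))

/-! ### Actions and events -/

/-- Memory actions: write, read, read-modify-write and fence. Read values are part of the
action. -/
inductive MemAct (Var Val : Type) : Type
  | W (x : Var) (v : Val)
  | R (x : Var) (v : Val)
  | RMW (x : Var) (vold vnew : Val)
  | F

/-- The action is a read or a write. -/
def MemAct.IsRW {Var Val : Type} : MemAct Var Val → Prop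
  | .W _ _ => True
  | .R _ _ => True
  | .RMW _ _ _ => False
  | .F => False

/-- Memory events: a process identifier and a memory action. -/
abbrev MemEv (P Var Val : Type) : Type := P × MemAct Var Val

/-- Object actions: invocations and responses. -/
inductive ObjAct (Op Ret : Type) : Type
  | inv (o : Op)
  | res (u : Ret)

/-- Object events: a process identifier and an object action. -/
abbrev ObjEv (P Op Ret : Type) : Type := P × ObjAct Op Ret

/-- Events: memory events (`Sum.inl`) and object events (`Sum.inr`). -/
abbrev Event (P Var Val Op Ret : Type) : Type := MemEv P Var Val ⊕ ObjEv P Op Ret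

/-- The process identifier of an event. -/
def evProc {P Var Val Op Ret : Type} : Event P Var Val Op Ret → P
  | .inl e => e.1
  | .inr e => e.1

/-- The restriction of a sequence of events to memory events. -/
def memPart {P Var Val Op Ret : Type} (π : List (Event P Var Val Op Ret)) :
    List (MemEv P Var Val) :=
  π.filterMap Sum.getLeft?

/-- The restriction of a sequence of events to object events. -/
def objPart {P Var Val Op Ret : Type} (π : List (Event P Var Val Op Ret)) :
    List (ObjEv P Op Ret) :=
  π.filterMap Sum.getRight?

/-! ### Memory models -/

/-- A memory model is an LTS whose labels are memory events (`some e`) and the silent internal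
step `none`. -/
abbrev MemModel (P Var Val : Type) : Type 1 := LTS (Option (MemEv P Var Val))

/-- Observable traces: traces with the silent steps erased. -/
def otraces {P Var Val : Type} (M : MemModel P Var Val) : Set (List (MemEv P Var Val)) :=
  {σ | ∃ ρ ∈ M.traces, ρ.reduceOption = σ}

/-- Transitions of total store order. A state is a main memory and a store buffer for every
process; the oldest entry of a buffer is the head of the list. -/
inductive TSOStep {P Var Val : Type} [DecidableEq P] [DecidableEq Var] :
    (Var → Val) × (P → List (Var × Val)) → Option (MemEv P Var Val) →
      (Var → Val) × (P → List (Var × Val)) → Prop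
  | write (m : Var → Val) (b : P → List (Var × Val)) (p : P) (x : Var) (v : Val) :
      TSOStep (m, b) (some (p, .W x v)) (m, Function.update b p (b p ++ [(x, v)]))
  | readBuffer (m : Var → Val) (b : P → List (Var × Val)) (p : P) (x : Var) (v : Val)
      (β : List (Var × Val)) :
      (b p).filter (fun e => e.1 = x) = β ++ [(x, v)] →
      TSOStep (m, b) (some (p, .R x v)) (m, b)
  | readMemory (m : Var → Val) (b : P → List (Var × Val)) (p : P) (x : Var) (v : Val) :
      (b p).filter (fun e => e.1 = x) = [] → m x = v →
      TSOStep (m, b) (some (p, .R x v)) (m, b)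
  | rmw (m : Var → Val) (b : P → List (Var × Val)) (p : P) (x : Var) (vold vnew : Val) :
      b p = [] → m x = vold →
      TSOStep (m, b) (some (p, .RMW x vold vnew)) (Function.update m x vnew, b)
  | fence (m : Var → Val) (b : P → List (Var × Val)) (p : P) :
      b p = [] → TSOStep (m, b) (some (p, .F)) (m, b)
  | propagate (m : Var → Val) (b : P → List (Var × Val)) (p : P) (x : Var) (v : Val)
      (β : List (Var × Val)) :
      b p = (x, v) :: β →
      TSOStep (m, b) none (Function.update m x v, Function.update b p β)

/-- The total store order memory model. -/
def TSO (P Var Val : Type) [DecidableEq P] [DecidableEq Var] [Zero Val] :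
    MemModel P Var Val where
  State := (Var → Val) × (P → List (Var × Val))
  start := (fun _ => 0, fun _ => [])
  Tr := TSOStep

/-- Messages of the release/acquire memory model. -/
structure Msg (Var Val : Type) : Type where
  var : Var
  val : Val
  time : ℕ
  view : Var → ℕ

/-- States of the release/acquire memory model: the set of messages, the view of every process,
and the view of the fences. -/
structure RAState (P Var Val : Type) : Type where
  mem : Set (Msg Var Val)
  view : P → Var → ℕ
  fview : Var → ℕ

/-- Transitions of release/acquire. The join `⊔` of views is the pointwise maximum. -/
inductive RAStep {P Var Val : Type} [DecidableEq P] [DecidableEq Var] :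
    RAState P Var Val → Option (MemEv P Var Val) → RAState P Var Val → Prop
  | write (m : Set (Msg Var Val)) (V : P → Var → ℕ) (Vf : Var → ℕ) (p : P) (x : Var) (v : Val)
      (t : ℕ) :
      V p x < t → (∀ μ ∈ m, μ.var = x → μ.time ≠ t) →
      RAStep ⟨m, V, Vf⟩ (some (p, .W x v))
        ⟨m ∪ {⟨x, v, t, Function.update (V p) x t⟩},
          Function.update V p (Function.update (V p) x t), Vf⟩
  | read (m : Set (Msg Var Val)) (V : P → Var → ℕ) (Vf : Var → ℕ) (p : P) (x : Var) (v : Val)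
      (U : Var → ℕ) :
      (⟨x, v, V p x, U⟩ : Msg Var Val) ∈ m →
      RAStep ⟨m, V, Vf⟩ (some (p, .R x v)) ⟨m, V, Vf⟩
  | rmw (m : Set (Msg Var Val)) (V : P → Var → ℕ) (Vf : Var → ℕ) (p : P) (x : Var)
      (vold vnew : Val) (U : Var → ℕ) :
      (⟨x, vold, V p x, U⟩ : Msg Var Val) ∈ m →
      (∀ μ ∈ m, μ.var = x → μ.time ≠ V p x + 1) →
      RAStep ⟨m, V, Vf⟩ (some (p, .RMW x vold vnew))
        ⟨m ∪ {⟨x, vnew, V p x + 1, Function.update (V p) x (V p x + 1)⟩},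
          Function.update V p (Function.update (V p) x (V p x + 1)), Vf⟩
  | fence (m : Set (Msg Var Val)) (V : P → Var → ℕ) (Vf : Var → ℕ) (p : P) :
      RAStep ⟨m, V, Vf⟩ (some (p, .F)) ⟨m, Function.update V p (V p ⊔ Vf), V p ⊔ Vf⟩
  | propagate (m : Set (Msg Var Val)) (V : P → Var → ℕ) (Vf : Var → ℕ) (p : P)
      (μ : Msg Var Val) :
      μ ∈ m → V p μ.var < μ.time →
      RAStep ⟨m, V, Vf⟩ none ⟨m, Function.update V p (V p ⊔ μ.view), Vf⟩

/-- The release/acquire memory model. -/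
def RA (P Var Val : Type) [DecidableEq P] [DecidableEq Var] [Zero Val] :
    MemModel P Var Val where
  State := RAState P Var Val
  start := ⟨{μ | ∃ x : Var, μ = ⟨x, 0, 0, fun _ => 0⟩}, fun _ _ => 0, fun _ => 0⟩
  Tr := RAStep

/-! ### Histories and objects -/

/-- The complete sequential history of a list of operations, each given by its process, its
operation name and its response value. -/
def seqHist {P Op Ret : Type} (l : List (P × Op × Ret)) : List (ObjEv P Op Ret) :=
  l.flatMap fun t => [(t.1, .inv t.2.1), (t.1, .res t.2.2)]

/-- Sequential histories. -/
def IsSequential {P Op Ret : Type} (h : List (ObjEv P Op Ret)) : Prop :=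
  ∃ l : List (P × Op × Ret), h <+: seqHist l

/-- Well-formed histories: the restriction to every process is sequential. -/
def WellFormed {P Op Ret : Type} [DecidableEq P] (h : List (ObjEv P Op Ret)) : Prop :=
  ∀ p : P, IsSequential (h.filter fun e => e.1 = p)

/-- Complete sequential histories. -/
def IsCompleteSequential {P Op Ret : Type} (h : List (ObjEv P Op Ret)) : Prop :=
  ∃ l : List (P × Op × Ret), h = seqHist l

/-- An object with operation names `Op` and response values `Ret` is given by its specification,
a prefix-closed set of complete sequential histories. -/
structure Obj (P Op Ret : Type) where
  spec : Set (List (ObjEv P Op Ret))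
  spec_sequential : ∀ h ∈ spec, IsCompleteSequential h
  spec_prefix : ∀ h ∈ spec, ∀ h', IsCompleteSequential h' → h' <+: h → h' ∈ spec

/-- The responses in a sequence of operations are those of the sequential machine with transition
function `next` and output function `out`, started in state `s`. -/
def Legal {P Op Ret S : Type} (next : S → Op → S) (out : S → Op → Ret) :
    S → List (P × Op × Ret) → Prop
  | _, [] => True
  | s, (_, o, u) :: l => u = out s o ∧ Legal next out (next s o) l

theorem seqHist_prefix_legal {P Op Ret S : Type} (next : S → Op → S) (out : S → Op → Ret)
    (l' : List (P × Op × Ret)) : ∀ (l : List (P × Op × Ret)) (s : S),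
      Legal next out s l → seqHist l' <+: seqHist l → Legal next out s l' := by
  induction l' with
  | nil => intro l s _ _; trivial
  | cons a l' ih =>
    intro l s hl hp
    cases l with
    | nil => simp [seqHist] at hp
    | cons b l =>
      obtain ⟨p, o, u⟩ := a
      obtain ⟨p', o', u'⟩ := b
      simp only [seqHist, List.flatMap_cons, List.cons_append, List.nil_append,
        List.cons_prefix_cons, Prod.mk.injEq, ObjAct.inv.injEq, ObjAct.res.injEq] at hp
      obtain ⟨⟨_, rfl⟩, ⟨_, rfl⟩, hp⟩ := hp
      exact ⟨hl.1, ih l _ hl.2 hp⟩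

/-- The object whose specification consists of the complete sequential histories produced by a
sequential machine. -/
def Obj.ofMachine (P : Type) {Op Ret S : Type} (s : S) (next : S → Op → S) (out : S → Op → Ret) :
    Obj P Op Ret where
  spec := {h | ∃ l, Legal next out s l ∧ h = seqHist l}
  spec_sequential := by
    rintro h ⟨l, _, rfl⟩
    exact ⟨l, rfl⟩
  spec_prefix := by
    rintro h ⟨l, hl, rfl⟩ h' ⟨l', rfl⟩ hp
    exact ⟨l', seqHist_prefix_legal next out l' l s hl hp, rfl⟩

/-- Operation names of (max-)registers. -/
inductive RegOp (α : Type) : Type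
  | write (a : α)
  | read

/-- Response values of (max-)registers. -/
inductive RegRet (α : Type) : Type
  | ack
  | val (a : α)

/-- Responses of (max-)registers with current content `s`. -/
def regOut {α β : Type} (s : β) : RegOp α → RegRet β
  | .write _ => .ack
  | .read => .val s

/-- The register with initial value `0` in which the values in `A` can be written. -/
def Reg (P : Type) {Val : Type} [Zero Val] (A : Set Val) : Obj P (RegOp A) (RegRet Val) :=
  Obj.ofMachine P (0 : Val)
    (fun s o => match o with
      | .write a => (a : Val)
      | .read => s)
    regOut

/-- The max-register that stores integers, with initial value `0`. -/
def MaxReg (P : Type) : Obj P (RegOp ℤ) (RegRet ℤ) :=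
  Obj.ofMachine P (0 : ℤ)
    (fun s o => match o with
      | .write a => max s a
      | .read => s)
    regOut

/-! ### Implementations -/

/-- An implementation of an operation for process `p`: an LTS whose labels are events of `p` and in
which a response is the last transition of every execution. -/
structure OpImpl {P : Type} (Var Val Op Ret : Type) (p : P) extends
    LTS (Event P Var Val Op Ret) where
  tr_proc : ∀ q e q', Tr q e q' → evProc e = p
  tr_res : ∀ q u q', Tr q (.inr (p, .res u)) q' → ∀ e q'', ¬ Tr q' e q''

/-- An implementation of an object. -/
abbrev Impl (P Var Val Op Ret : Type) : Type 1 :=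
  Op → (p : P) → OpImpl Var Val Op Ret p

variable {P Var Val Op Ret : Type}

/-- Transitions of a single process that repeatedly executes operations; `none` means that no
operation is being executed. -/
inductive SysPStep (I : Impl P Var Val Op Ret) (p : P) :
    Option (Σ o : Op, (I o p).State) → Event P Var Val Op Ret →
      Option (Σ o : Op, (I o p).State) → Prop
  | inv (o : Op) : SysPStep I p none (.inr (p, .inv o)) (some ⟨o, (I o p).start⟩)
  | mem (o : Op) (q q' : (I o p).State) (e : MemEv P Var Val) :
      (I o p).Tr q (.inl e) q' → SysPStep I p (some ⟨o, q⟩) (.inl e) (some ⟨o, q'⟩)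
  | res (o : Op) (q q' : (I o p).State) (u : Ret) :
      (I o p).Tr q (.inr (p, .res u)) q' →
      SysPStep I p (some ⟨o, q⟩) (.inr (p, .res u)) none

/-- The LTS that interleaves the processes. -/
def Impl.sys [DecidableEq P] (I : Impl P Var Val Op Ret) : LTS (Event P Var Val Op Ret) where
  State := (p : P) → Option (Σ o : Op, (I o p).State)
  start := fun _ => none
  Tr q e q' := ∃ p r, SysPStep I p (q p) e r ∧ q' = Function.update q p r

/-- Histories generated by `I` under the memory model `M`. -/
def Impl.hist [DecidableEq P] (I : Impl P Var Val Op Ret) (M : MemModel P Var Val) :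
    Set (List (ObjEv P Op Ret)) :=
  {h | ∃ π ∈ I.sys.traces, memPart π ∈ otraces M ∧ objPart π = h}

/-! ### Linearizability -/

/-- `s'` is an `R`-reordering of `s`. -/
def IsReordering {X : Type} (R : X → X → Prop) (s s' : List X) : Prop :=
  ∃ f : Fin s.length ≃ Fin s'.length,
    (∀ i, s.get i = s'.get (f i)) ∧ ∀ i j, i < j → R (s.get i) (s.get j) → f i < f j

/-- Invocation events. -/
def IsInv (e : ObjEv P Op Ret) : Prop := ∃ o, e.2 = .inv o

/-- Response events. -/
def IsRes (e : ObjEv P Op Ret) : Prop := ∃ u, e.2 = .res u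

/-- The pairs whose order a linearization preserves: events of the same process, and a response
before an invocation. -/
def linRel (e₁ e₂ : ObjEv P Op Ret) : Prop :=
  e₁.1 = e₂.1 ∨ (IsRes e₁ ∧ IsInv e₂)

open Classical in
/-- Removes the pending invocations of a well-formed history: those that are not followed by an
event of the same process. -/
noncomputable def dropPending : List (ObjEv P Op Ret) → List (ObjEv P Op Ret)
  | [] => []
  | e :: h => if IsInv e ∧ ∀ e' ∈ h, e'.1 ≠ e.1 then dropPending h else e :: dropPending h

/-- A history is linearizable w.r.t. `O` if, after appending responses to some of its pending
operations and dropping the remaining pending invocations, it can be reordered to a history of the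
specification so that the order in every process and the real-time order of operations are
preserved. -/
def IsLinearizable [DecidableEq P] (O : Obj P Op Ret) (h : List (ObjEv P Op Ret)) : Prop :=
  ∃ r : List (ObjEv P Op Ret), (∀ e ∈ r, IsRes e) ∧ WellFormed (h ++ r) ∧
    ∃ s ∈ O.spec, IsReordering linRel (dropPending (h ++ r)) s

/-- `I` is a linearizable implementation of `O` under `M`. -/
def Linearizable [DecidableEq P] (O : Obj P Op Ret) (I : Impl P Var Val Op Ret)
    (M : MemModel P Var Val) : Prop :=
  ∀ h ∈ I.hist M, IsLinearizable O h

/-! ### Wait-freedom -/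

/-- Transitions of the system of all processes running on top of the memory model. -/
inductive UnderStep [DecidableEq P] (I : Impl P Var Val Op Ret) (M : MemModel P Var Val) :
    I.sys.State × M.State → Option (Event P Var Val Op Ret) → I.sys.State × M.State → Prop
  | silent (q : I.sys.State) (s s' : M.State) :
      M.Tr s none s' → UnderStep I M (q, s) none (q, s')
  | mem (q q' : I.sys.State) (s s' : M.State) (e : MemEv P Var Val) :
      I.sys.Tr q (.inl e) q' → M.Tr s (some e) s' →
      UnderStep I M (q, s) (some (.inl e)) (q', s')
  | obj (q q' : I.sys.State) (s : M.State) (e : ObjEv P Op Ret) :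
      I.sys.Tr q (.inr e) q' → UnderStep I M (q, s) (some (.inr e)) (q', s)

/-- The processes of `I` running on top of the memory model `M`. -/
def Impl.under [DecidableEq P] (I : Impl P Var Val Op Ret) (M : MemModel P Var Val) :
    LTS (Option (Event P Var Val Op Ret)) where
  State := I.sys.State × M.State
  start := (I.sys.start, M.start)
  Tr := UnderStep I M

/-- The label is an event of process `p`. -/
def IsStepOf (p : P) (l : Option (Event P Var Val Op Ret)) : Prop :=
  ∃ e, l = some e ∧ evProc e = p

/-- The label is a response event of process `p`. -/
def IsResOf (p : P) (l : Option (Event P Var Val Op Ret)) : Prop :=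
  ∃ u, l = some (.inr (p, .res u))

/-- `I` is wait-free under `M`: every operation terminates after finitely many steps of the process
that executes it, whatever the other processes do. That is,
* in an infinite execution, a process that takes infinitely many steps completes infinitely many
  operations;
* a process in the middle of an operation is never stuck, i.e. it can take a step, possibly after
  internal steps of the memory;
* a process that reads a variable accepts every value. -/
structure WaitFree [DecidableEq P] (I : Impl P Var Val Op Ret) (M : MemModel P Var Val) :
    Prop where
  terminates : ∀ c l, (I.under M).IsInfiniteRun c l → ∀ p : P,
    (∀ n, ∃ k, n ≤ k ∧ IsStepOf p (l k)) → ∀ n, ∃ k, n ≤ k ∧ IsResOf p (l k)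
  not_stuck : ∀ π c, (I.under M).Run (I.under M).start π c → ∀ p : P, c.1 p ≠ none →
    ∃ n c' l c'', (I.under M).Run c (List.replicate n none) c' ∧
      (I.under M).Tr c' l c'' ∧ IsStepOf p l
  accepts : ∀ o p q x v q', (I o p).Tr q (.inl (p, .R x v)) q' →
    ∀ v', ∃ q'', (I o p).Tr q (.inl (p, .R x v')) q''

/-! ### Placement of fences -/

/-- Every complete execution of `A` performs `i` fences, then only reads and writes, and then `j`
fences; incomplete executions are prefixes of this form. -/
def FenceShape {p : P} (A : OpImpl Var Val Op Ret p) (i j : ℕ) : Prop :=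
  ∀ π ∈ A.traces, ∃ σ : List (MemEv P Var Val), (∀ e ∈ σ, e.2.IsRW) ∧
    memPart π <+: List.replicate i (p, .F) ++ σ ++ List.replicate j (p, .F) ∧
    ((∃ e ∈ objPart π, IsRes e) →
      memPart π = List.replicate i (p, .F) ++ σ ++ List.replicate j (p, .F))

/-- Only reads and writes, and a single fence at the end of `write`. -/
def FenceAfterWrite {α β : Type} (I : Impl P Var Val (RegOp α) (RegRet β)) : Prop :=
  ∀ p, (∀ a, FenceShape (I (.write a) p) 0 1) ∧ FenceShape (I .read p) 0 0

/-- Only reads and writes, and one fence at the beginning and one fence at the end of both `write`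
and `read`. -/
def FenceAround {α β : Type} (I : Impl P Var Val (RegOp α) (RegRet β)) : Prop :=
  ∀ p, (∀ a, FenceShape (I (.write a) p) 1 1) ∧ FenceShape (I .read p) 1 1

/-! ### The collect-based max-register

    read():    fence; m = collect(M); fence; return max(m)
    write(v):  fence; m = collect(M); if max(m) < v then M[p] = v; fence; return ack

The collect reads the entries of the shared array `M` one by one, in an arbitrary order. -/

/-- Control states: in `collecting S m` the entries in `S` remain to be read and `m` holds the
values read so far; in `returning u` the process is about to return `u`. -/
inductive CollectState (N : ℕ) : Type
  | begin
  | collecting (S : Finset (Fin N)) (m : Fin N → ℤ)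
  | written
  | returning (u : RegRet ℤ)
  | finished

/-- The maximum of a collected array; `p` witnesses that the array is not empty. -/
def arrayMax {N : ℕ} (p : Fin N) (m : Fin N → ℤ) : ℤ :=
  Finset.univ.sup' ⟨p, Finset.mem_univ p⟩ m

/-- Transitions of operation `o` of process `p`; the shared array is `M`, and `ι` gives the
representation of integers as values of the shared memory. -/
inductive CollectStep {N : ℕ} (M : Fin N ↪ Var) (ι : ℤ ↪ Val) (o : RegOp ℤ) (p : Fin N) :
    CollectState N → Event (Fin N) Var Val (RegOp ℤ) (RegRet ℤ) → CollectState N → Prop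
  | fence₁ : CollectStep M ι o p .begin (.inl (p, .F)) (.collecting Finset.univ fun _ => 0)
  | collect (S : Finset (Fin N)) (m : Fin N → ℤ) (i : Fin N) (v : Val) :
      i ∈ S → CollectStep M ι o p (.collecting S m) (.inl (p, .R (M i) v))
        (.collecting (S.erase i) (Function.update m i (Function.invFun ι v)))
  | readFence (m : Fin N → ℤ) :
      o = .read → CollectStep M ι o p (.collecting ∅ m) (.inl (p, .F))
        (.returning (.val (arrayMax p m)))
  | write (m : Fin N → ℤ) (v : ℤ) :
      o = .write v → arrayMax p m < v →
      CollectStep M ι o p (.collecting ∅ m) (.inl (p, .W (M p) (ι v))) .written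
  | writeFence : CollectStep M ι o p .written (.inl (p, .F)) (.returning .ack)
  | skipFence (m : Fin N → ℤ) (v : ℤ) :
      o = .write v → ¬ arrayMax p m < v →
      CollectStep M ι o p (.collecting ∅ m) (.inl (p, .F)) (.returning .ack)
  | respond (u : RegRet ℤ) :
      CollectStep M ι o p (.returning u) (.inr (p, .res u)) .finished

/-- The collect-based implementation of the max-register. -/
def collectMaxReg {N : ℕ} (M : Fin N ↪ Var) (ι : ℤ ↪ Val) :
    Impl (Fin N) Var Val (RegOp ℤ) (RegRet ℤ) := fun o p =>
  { State := CollectState N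
    start := .begin
    Tr := CollectStep M ι o p
    tr_proc := by
      intro q e q' h
      cases h <;> rfl
    tr_res := by
      intro q u q' h e q'' h'
      cases h
      cases h' }

end WMM

open WMM

/-! The proof separates a combinatorial core, the keyed machine, from simulations of the concrete
algorithms.

In a keyed machine every operation commits at a key of a linear order. An effective operation at `k`
produces a state that depends on `k` alone: it must give the same state and response from every
admissible state at every key `c ≤ k`. All other operations observe the state at their key and leave
it unchanged. The linearization sorts operations by key, effective ones first, then by invocation.
It is legal because an effective operation does not care which state it finds, so keys may be chosen
in any order in time; under release/acquire this is needed, since a write may pick a timestamp below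
one already in use. Real time is respected because an invocation records as its floor the largest
key of a completed operation; observers commit at or above the floor, effective operations strictly
above it. This is `KReach.recorded`, `legal_of_sorted` and `Recorded.isLinearizable`;
`linearizable_of_simulation` transfers it to implementations.

For registers the keys come from the memory. Under RA the key is the timestamp in the single
variable: the closing fence publishes it in the fence view, and the opening fence imports the floor
from there. Under TSO the key counts the writes that have reached the main memory, and a write takes
effect when it is propagated.

For max-registers the key is the value itself, and the state at key `k` is `k`. A write of `v` above
the collected maximum is effective at `v`, because `max c v = v` for `c ≤ v`. A smaller write, and
every read, observes at the collected maximum. That maximum is not below the floor, because each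
entry has a single writer that has read its own latest value before overwriting it with a larger
one, so entries only grow along their timestamps.

Wait-freedom follows from a rank that drops at every step of the process, together with the fact
that both memories can always serve a read, a write or a fence, possibly after silent steps. -/

namespace WMM

/-! ### Reorderings of lists with distinct elements -/

/-- Two duplicate-free lists with the same elements, the second of which is sorted by `lt`, give
rise to a reordering. -/
theorem isReordering_of_pairwise {T X : Type} [DecidableEq T] {R : X → X → Prop} (g : T → X)
    {lt : T → T → Prop} (asymm : ∀ x y, lt x y → ¬ lt y x) {l l' : List T} (hl : l.Nodup)
    (hl' : l'.Nodup) (hmem : ∀ x, x ∈ l ↔ x ∈ l') (hsorted : l'.Pairwise lt)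
    (hR : l.Pairwise fun x y => R (g x) (g y) → lt x y) :
    IsReordering R (l.map g) (l'.map g) := by
  -- Without duplicates, positions correspond to elements, so the bijection between positions is
  -- forced: it sends each element to its place in the other list.
  let e : Fin l.length ≃ Fin l'.length :=
    (hl.getEquiv l).trans ((Equiv.subtypeEquivRight hmem).trans (hl'.getEquiv l').symm)
  have he : ∀ i, l'.get (e i) = l.get i := by
    intro i
    simp [e]
  refine ⟨(finCongr (by simp)).trans (e.trans (finCongr (by simp))), ?_, ?_⟩
  · intro i
    have h := he (Fin.cast (by simp) i)
    simp only [List.get_eq_getElem] at h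
    simpa using congrArg g h.symm
  · intro i j hij hr
    set i' : Fin l.length := Fin.cast (by simp) i
    set j' : Fin l.length := Fin.cast (by simp) j
    have hij' : i' < j' := hij
    have hlt : lt (l.get i') (l.get j') := by
      refine List.pairwise_iff_get.1 hR i' j' hij' ?_
      simpa [i', j'] using hr
    change e i' < e j'
    by_contra hcon
    rcases lt_or_eq_of_le (not_lt.1 hcon) with h | h
    · have := List.pairwise_iff_get.1 hsorted _ _ h
      rw [he, he] at this
      exact asymm _ _ hlt this
    · exact absurd (e.injective h) (ne_of_gt hij')

/-- Describes `dropPending` on the image of a list. -/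
theorem dropPending_map {T P Op Ret : Type} (g : T → ObjEv P Op Ret) (keep : T → Prop)
    [DecidablePred keep] (l : List T)
    (h : ∀ l₁ x l₂, l = l₁ ++ x :: l₂ →
      (keep x ↔ ¬ (IsInv (g x) ∧ ∀ y ∈ l₂, (g y).1 ≠ (g x).1))) :
    dropPending (l.map g) = (l.filter keep).map g := by
  induction l with
  | nil => rfl
  | cons x l ih =>
    have ih := ih fun l₁ y l₂ hl => h (x :: l₁) y l₂ (by simp [hl])
    have hx := h [] x l rfl
    by_cases hk : keep x
    · have := hx.1 hk
      rw [List.map_cons, dropPending, if_neg, List.filter_cons_of_pos (by simpa using hk), ih,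
        List.map_cons]
      simpa using this
    · have := not_not.1 (mt hx.2 hk)
      rw [List.map_cons, dropPending, if_pos, List.filter_cons_of_neg (by simpa using hk), ih]
      simpa using this

/-! ### Keyed machines

Every operation takes effect at a key of a linear order. Effective operations determine the state
of the object at their key, all others observe the state at theirs. The keys need not be chosen in
increasing order, but have to respect the real-time order of operations. -/

/-- The status of a process in a keyed machine. In `pending o f`, all operations that were
completed before the invocation of `o` have keys of at most `f`. -/
inductive Status (K Op Ret : Type) : Type
  | idle
  | pending (o : Op) (f : K)
  | committed (u : Ret) (k : K)

/-- States of a keyed machine: the status of every process, an upper bound of the keys of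
completed operations, the set of keys in use and the object state at every key. -/
structure KState (P K Op Ret S : Type) : Type where
  status : P → Status K Op Ret
  done : K
  keys : Set K
  val : K → S

section Keyed

variable {P K Op Ret S : Type} [LinearOrder K]

/-- A record of an operation: its process, name and floor, and, once it is committed, its response,
its key and whether it is effective. -/
structure OpRec (P K Op Ret : Type) : Type where
  proc : P
  op : Op
  floor : K
  ret : Ret
  key : K
  eff : Bool

/-- The invocation (`false`) or the response (`true`) of the operation with a given index. -/
def recEvent {P K Op Ret : Type} (rec : ℕ → OpRec P K Op Ret) (x : ℕ × Bool) : ObjEv P Op Ret :=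
  ((rec x.1).proc, if x.2 then .res (rec x.1).ret else .inv (rec x.1).op)

/-- Admissible order of the events `x`, `y` in a history. -/
def RecOrder {P K Op Ret : Type} [LinearOrder K] (rec : ℕ → OpRec P K Op Ret)
    (x y : ℕ × Bool) : Prop :=
  (x.2 = false → y.2 = false → x.1 < y.1) ∧
  (x.2 = true → y.2 = false → x.1 < y.1 ∧ (rec x.1).key ≤ (rec y.1).floor) ∧
  ((rec x.1).proc = (rec y.1).proc → x.1 ≤ y.1)

/-- The history `h` of the state `a` is described by the records of the operations `i < n`, of
which those in `C` are committed. The list `H` consists of the invocations and responses. -/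
structure Recorded {P K Op Ret S : Type} [LinearOrder K]
    (next : S → Op → S) (out : S → Op → Ret) (ok : K → S → Prop) (k₀ : K) (s₀ : S)
    (n : ℕ) (rec : ℕ → OpRec P K Op Ret) (C : Finset ℕ) (H : List (ℕ × Bool)) (cur : P → ℕ)
    (h : List (ObjEv P Op Ret)) (a : KState P K Op Ret S) : Prop where
  hist : h = H.map (recEvent rec)
  mem_inv : ∀ i, (i, false) ∈ H ↔ i < n
  mem_res : ∀ i, (i, true) ∈ H → i ∈ C
  lt_of_mem : ∀ i ∈ C, i < n
  nodup : H.Nodup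
  order : H.Pairwise (RecOrder rec)
  idle : ∀ p, a.status p = .idle → ∀ i < n, (rec i).proc = p → (i, true) ∈ H
  busy : ∀ p, a.status p ≠ .idle → cur p < n ∧ (rec (cur p)).proc = p ∧ (cur p, true) ∉ H ∧
    ∀ i < n, (rec i).proc = p → i ≠ cur p → i < cur p ∧ (i, true) ∈ H
  pending : ∀ p o f, a.status p = .pending o f →
    cur p ∉ C ∧ (rec (cur p)).op = o ∧ (rec (cur p)).floor = f
  committed : ∀ p u k, a.status p = .committed u k →
    cur p ∈ C ∧ (rec (cur p)).ret = u ∧ (rec (cur p)).key = k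
  key_le_done : ∀ i, (i, true) ∈ H → (rec i).key ≤ a.done
  floor_le : ∀ i ∈ C, (rec i).floor ≤ (rec i).key
  floor_lt : ∀ i ∈ C, (rec i).eff = true → (rec i).floor < (rec i).key
  key_mem : ∀ i ∈ C, (rec i).key ∈ a.keys
  start_mem : k₀ ∈ a.keys
  start_le : ∀ k ∈ a.keys, k₀ ≤ k
  val_ok : ∀ k ∈ a.keys, ok k (a.val k)
  val_start : a.val k₀ = s₀
  exists_eff : ∀ k ∈ a.keys, k = k₀ ∨ ∃ i ∈ C, (rec i).eff = true ∧ (rec i).key = k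
  effect : ∀ i ∈ C, (rec i).eff = true → ∀ c ≤ (rec i).key, ∀ s, ok c s →
    next s (rec i).op = a.val (rec i).key ∧ out s (rec i).op = (rec i).ret
  observe : ∀ i ∈ C, (rec i).eff = false →
    next (a.val (rec i).key) (rec i).op = a.val (rec i).key ∧
    out (a.val (rec i).key) (rec i).op = (rec i).ret

variable {next : S → Op → S} {out : S → Op → Ret} {ok : K → S → Prop} {k₀ : K} {s₀ : S}
  {h : List (ObjEv P Op Ret)} {a : KState P K Op Ret S}

theorem Recorded.lt_of_mem_hist {n : ℕ} {rec : ℕ → OpRec P K Op Ret} {C : Finset ℕ}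
    {H : List (ℕ × Bool)} {cur : P → ℕ}
    (R : Recorded next out ok k₀ s₀ n rec C H cur h a) {x : ℕ × Bool} (hx : x ∈ H) :
    x.1 < n := by
  obtain ⟨i, b⟩ := x
  cases b
  · exact (R.mem_inv i).1 hx
  · exact R.lt_of_mem i (R.mem_res i hx)

variable [DecidableEq P]

/-- Reachable states of the keyed machine, together with the history produced. `ok` is an invariant
of the object states at a key. -/
inductive KReach (next : S → Op → S) (out : S → Op → Ret) (ok : K → S → Prop) (k₀ : K) (s₀ : S) :
    List (ObjEv P Op Ret) → KState P K Op Ret S → Prop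
  | init : KReach next out ok k₀ s₀ [] ⟨fun _ => .idle, k₀, {k₀}, fun _ => s₀⟩
  | inv {h : List (ObjEv P Op Ret)} {a : KState P K Op Ret S} (p : P) (o : Op) :
      KReach next out ok k₀ s₀ h a → a.status p = .idle →
      KReach next out ok k₀ s₀ (h ++ [(p, .inv o)])
        { a with status := Function.update a.status p (.pending o a.done) }
  -- The bound `f < k` is strict because effective operations are placed first among those with
  -- equal keys: a completed observer at `f` must still precede this one. Several effective
  -- operations may share a key, provided they agree on its state.
  | effect {h : List (ObjEv P Op Ret)} {a : KState P K Op Ret S} (p : P) (o : Op) (f k : K) (s : S)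
      (u : Ret) :
      KReach next out ok k₀ s₀ h a → a.status p = .pending o f → f < k → k₀ ≤ k → ok k s →
      (k ∈ a.keys → a.val k = s) →
      (∀ c ≤ k, ∀ s', ok c s' → next s' o = s ∧ out s' o = u) →
      KReach next out ok k₀ s₀ h
        { a with
          status := Function.update a.status p (.committed u k)
          keys := insert k a.keys
          val := Function.update a.val k s }
  | observe {h : List (ObjEv P Op Ret)} {a : KState P K Op Ret S} (p : P) (o : Op) (f k : K) :
      KReach next out ok k₀ s₀ h a → a.status p = .pending o f → f ≤ k → k ∈ a.keys →
      next (a.val k) o = a.val k →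
      KReach next out ok k₀ s₀ h
        { a with status := Function.update a.status p (.committed (out (a.val k) o) k) }
  | res {h : List (ObjEv P Op Ret)} {a : KState P K Op Ret S} (p : P) (u : Ret) (k : K) :
      KReach next out ok k₀ s₀ h a → a.status p = .committed u k →
      KReach next out ok k₀ s₀ (h ++ [(p, .res u)])
        { a with
          status := Function.update a.status p .idle
          done := max a.done k }

/-- The history of a process in a given state of the keyed machine. -/
theorem KReach.filter_eq (hr : KReach next out ok k₀ s₀ h a) (p : P) :
    ∃ l : List (P × Op × Ret),
      (a.status p = .idle ∧ h.filter (fun e => e.1 = p) = seqHist l) ∨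
      (a.status p ≠ .idle ∧ ∃ o, h.filter (fun e => e.1 = p) = seqHist l ++ [(p, .inv o)]) := by
  induction hr with
  | init => exact ⟨[], .inl ⟨rfl, rfl⟩⟩
  | @inv h a q o _ hq ih =>
    obtain ⟨l, ih⟩ := ih
    refine ⟨l, ?_⟩
    by_cases hqp : q = p
    · subst hqp
      rcases ih with ⟨_, ih⟩ | ⟨ih, _⟩
      · exact .inr ⟨by simp, o, by simp [List.filter_append, ih]⟩
      · exact absurd hq ih
    · simpa [List.filter_append, hqp, Function.update_of_ne (Ne.symm hqp)] using ih
  | @effect h a q o f k s u _ hq _ _ _ _ _ ih =>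
    obtain ⟨l, ih⟩ := ih
    refine ⟨l, ?_⟩
    by_cases hqp : q = p
    · subst hqp
      rcases ih with ⟨ih, _⟩ | ⟨_, ih⟩
      · simp [hq] at ih
      · exact .inr ⟨by simp, ih⟩
    · simpa [Function.update_of_ne (Ne.symm hqp)] using ih
  | @observe h a q o f k _ hq _ _ _ ih =>
    obtain ⟨l, ih⟩ := ih
    refine ⟨l, ?_⟩
    by_cases hqp : q = p
    · subst hqp
      rcases ih with ⟨ih, _⟩ | ⟨_, ih⟩
      · simp [hq] at ih
      · exact .inr ⟨by simp, ih⟩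
    · simpa [Function.update_of_ne (Ne.symm hqp)] using ih
  | @res h a q u k _ hq ih =>
    obtain ⟨l, ih⟩ := ih
    by_cases hqp : q = p
    · subst hqp
      rcases ih with ⟨ih, _⟩ | ⟨_, o, ih⟩
      · simp [hq] at ih
      · exact ⟨l ++ [(q, o, u)], .inl ⟨by simp, by simp [List.filter_append, ih, seqHist]⟩⟩
    · exact ⟨l, by simpa [List.filter_append, hqp, Function.update_of_ne (Ne.symm hqp)] using ih⟩

theorem KReach.wellFormed (hr : KReach next out ok k₀ s₀ h a) : WellFormed h := by
  intro p
  obtain ⟨l, ⟨_, hl⟩ | ⟨_, o, hl⟩⟩ := hr.filter_eq p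
  · exact ⟨l, by rw [hl]⟩
  · rw [hl]
    exact ⟨l ++ [(p, o, out s₀ o)], by simp [seqHist]⟩

-- A machine state forgets the keys of finished operations, which the linearization needs. The
-- records keep them as ghost data: operations are numbered by invocation, `cur p` is the latest
-- operation of a busy process, and a record is rewritten only once, at the commit.
set_option maxHeartbeats 4000000 in
theorem KReach.recorded [Nonempty P] [Nonempty Op] (hok : ok k₀ s₀)
    (hr : KReach next out ok k₀ s₀ h a) :
    ∃ n rec C H cur, Recorded next out ok k₀ s₀ n rec C H cur h a := by
  induction hr with
  | init =>
    obtain ⟨p⟩ := ‹Nonempty P›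
    obtain ⟨o⟩ := ‹Nonempty Op›
    refine ⟨0, fun _ => ⟨p, o, k₀, out s₀ o, k₀, true⟩, ∅, [], fun _ => 0, ?_⟩
    constructor <;> simp_all
  | @inv h a p o _ hp ih =>
    obtain ⟨n, rec, C, H, cur, R⟩ := ih
    have hlt : ∀ x ∈ H, x.1 < n := fun x hx => R.lt_of_mem_hist hx
    -- Only the process, the name and the floor are meaningful yet; response, key and effectiveness
    -- are placeholders until the operation commits.
    set rec' := Function.update rec n ⟨p, o, a.done, out s₀ o, k₀, true⟩ with hrec'
    have hrec : ∀ i, i < n → rec' i = rec i := fun i hi => Function.update_of_ne (by omega) _ _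
    have hn : rec' n = ⟨p, o, a.done, out s₀ o, k₀, true⟩ := Function.update_self _ _ _
    clear_value rec'
    refine ⟨n + 1, rec', C, H ++ [(n, false)], Function.update cur p n, ?_⟩
    have hC : ∀ i ∈ C, rec' i = rec i := fun i hi => hrec i (R.lt_of_mem i hi)
    constructor
    case hist =>
      rw [R.hist, List.map_append]
      congr 1
      · refine List.map_congr_left fun x hx => ?_
        simp [recEvent, hrec _ (hlt x hx)]
      · simp [recEvent, hn]
    case order =>
      rw [List.pairwise_append]
      refine ⟨R.order.imp_of_mem fun {x y} hx hy hxy => ?_, by simp, ?_⟩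
      · simpa [RecOrder, hrec _ (hlt x hx), hrec _ (hlt y hy)] using hxy
      · intro x hx y hy
        rw [List.mem_singleton] at hy
        subst hy
        have h1 := hlt x hx
        refine ⟨fun _ _ => h1, fun hx2 _ => ⟨h1, ?_⟩, fun _ => h1.le⟩
        have : (x.1, true) ∈ H := by rw [← hx2]; exact hx
        simpa [hn, hrec _ h1] using R.key_le_done _ this
    case nodup =>
      have := R.nodup
      grind
    all_goals cases R; clear hrec'
    all_goals grind [Function.update_apply]
  | @effect h a p o f k s u _ hp hf hk hks hval hnext ih =>
    obtain ⟨n, rec, C, H, cur, R⟩ := ih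
    obtain ⟨hcn, hcp, hcH, hcur⟩ := R.busy p (by simp [hp])
    obtain ⟨hcC, hco, hcf⟩ := R.pending p o f hp
    set rec' := Function.update rec (cur p) ⟨p, o, f, u, k, true⟩ with hrec'
    have hrec : ∀ i, i ≠ cur p → rec' i = rec i := fun i hi => Function.update_of_ne hi _ _
    have hn : rec' (cur p) = ⟨p, o, f, u, k, true⟩ := Function.update_self _ _ _
    clear_value rec'
    have hproc : ∀ i, (rec' i).proc = (rec i).proc := by grind
    have hop : ∀ i, (rec' i).op = (rec i).op := by grind
    have hfloor : ∀ i, (rec' i).floor = (rec i).floor := by grind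
    have hC : ∀ i ∈ C, rec' i = rec i := by grind
    have hH : ∀ i, (i, true) ∈ H → rec' i = rec i := by grind
    refine ⟨n, rec', insert (cur p) C, H, cur, ?_⟩
    constructor
    case hist =>
      rw [R.hist]
      refine List.map_congr_left fun x hx => ?_
      obtain ⟨i, b⟩ := x
      cases b
      · simp [recEvent, hproc, hop]
      · simp [recEvent, hH i hx]
    case order =>
      refine R.order.imp_of_mem fun {x y} hx hy hxy => ?_
      obtain ⟨i, b⟩ := x
      cases b
      · simpa [RecOrder, hproc] using hxy
      · simpa [RecOrder, hproc, hfloor, hH i hx] using hxy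
    all_goals cases R; clear hrec'
    all_goals grind [Function.update_apply]
  | @observe h a p o f k _ hp hf hk hnext ih =>
    obtain ⟨n, rec, C, H, cur, R⟩ := ih
    obtain ⟨hcn, hcp, hcH, hcur⟩ := R.busy p (by simp [hp])
    obtain ⟨hcC, hco, hcf⟩ := R.pending p o f hp
    set rec' := Function.update rec (cur p) ⟨p, o, f, out (a.val k) o, k, false⟩ with hrec'
    have hrec : ∀ i, i ≠ cur p → rec' i = rec i := fun i hi => Function.update_of_ne hi _ _
    have hn : rec' (cur p) = ⟨p, o, f, out (a.val k) o, k, false⟩ := Function.update_self _ _ _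
    clear_value rec'
    have hproc : ∀ i, (rec' i).proc = (rec i).proc := by grind
    have hop : ∀ i, (rec' i).op = (rec i).op := by grind
    have hfloor : ∀ i, (rec' i).floor = (rec i).floor := by grind
    have hC : ∀ i ∈ C, rec' i = rec i := by grind
    have hH : ∀ i, (i, true) ∈ H → rec' i = rec i := by grind
    refine ⟨n, rec', insert (cur p) C, H, cur, ?_⟩
    constructor
    case hist =>
      rw [R.hist]
      refine List.map_congr_left fun x hx => ?_
      obtain ⟨i, b⟩ := x
      cases b
      · simp [recEvent, hproc, hop]
      · simp [recEvent, hH i hx]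
    case order =>
      refine R.order.imp_of_mem fun {x y} hx hy hxy => ?_
      obtain ⟨i, b⟩ := x
      cases b
      · simpa [RecOrder, hproc] using hxy
      · simpa [RecOrder, hproc, hfloor, hH i hx] using hxy
    all_goals cases R; clear hrec'
    all_goals grind [Function.update_apply]
  | @res h a p u k _ hp ih =>
    obtain ⟨n, rec, C, H, cur, R⟩ := ih
    obtain ⟨hcn, hcp, hcH, hcur⟩ := R.busy p (by simp [hp])
    obtain ⟨hcC, hcu, hck⟩ := R.committed p u k hp
    have hlt : ∀ x ∈ H, x.1 < n := fun x hx => R.lt_of_mem_hist hx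
    refine ⟨n, rec, C, H ++ [(cur p, true)], cur, ?_⟩
    constructor
    case hist => simp [R.hist, recEvent, hcp, hcu]
    case order =>
      rw [List.pairwise_append]
      refine ⟨R.order, by simp, ?_⟩
      intro x hx y hy
      rw [List.mem_singleton] at hy
      subst hy
      refine ⟨by simp, by simp, fun hproc => ?_⟩
      -- The responding operation is the latest one of its process, so no event of that process
      -- belongs to a larger index.
      by_contra hcon
      have := (hcur x.1 (hlt x hx) (hproc.trans hcp) (by simp at hcon; omega)).1
      simp at hcon
      omega
    case nodup =>
      have := R.nodup
      grind
    all_goals cases R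
    all_goals grind [Function.update_apply]

end Keyed

/-! ### Sorting the records into a legal linearization. -/

section Keyed

variable {P K Op Ret S : Type}
variable {next : S → Op → S} {out : S → Op → Ret} {ok : K → S → Prop} {k₀ : K} {s₀ : S}
  {h : List (ObjEv P Op Ret)} {a : KState P K Op Ret S}

/-- The position of an operation in the linearization: operations are sorted by their keys,
effective ones first, then by their invocations. -/
def OpRec.rank (rec : ℕ → OpRec P K Op Ret) (i : ℕ) : K ×ₗ Bool ×ₗ ℕ :=
  toLex ((rec i).key, toLex (!(rec i).eff, i))

theorem OpRec.rank_injective (rec : ℕ → OpRec P K Op Ret) :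
    Function.Injective (OpRec.rank rec) := by
  intro i j hij
  simpa [OpRec.rank] using (congrArg (fun x => (ofLex (ofLex x).2).2) hij)

/-- The events of the operations in a list. -/
def opEvents (l : List ℕ) : List (ℕ × Bool) := l.flatMap fun i => [(i, false), (i, true)]

theorem mem_opEvents {l : List ℕ} {x : ℕ × Bool} : x ∈ opEvents l ↔ x.1 ∈ l := by
  obtain ⟨i, b⟩ := x
  cases b <;> simp [opEvents]

theorem map_opEvents (rec : ℕ → OpRec P K Op Ret) (l : List ℕ) :
    (opEvents l).map (recEvent rec) =
      seqHist (l.map fun i => ((rec i).proc, (rec i).op, (rec i).ret)) := by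
  induction l with
  | nil => rfl
  | cons i l ih =>
    simp only [opEvents, List.flatMap_cons, List.map_append, List.map_cons, seqHist] at ih ⊢
    rw [ih]
    simp [recEvent]

variable [LinearOrder K]

theorem OpRec.rank_lt_iff (rec : ℕ → OpRec P K Op Ret) (i j : ℕ) :
    OpRec.rank rec i < OpRec.rank rec j ↔ (rec i).key < (rec j).key ∨
      (rec i).key = (rec j).key ∧ ((rec i).eff = true ∧ (rec j).eff = false ∨
        (rec i).eff = (rec j).eff ∧ i < j) := by
  simp only [OpRec.rank, Prod.Lex.toLex_lt_toLex]
  cases (rec i).eff <;> cases (rec j).eff <;> simp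

/-- Sorted records are legal. -/
theorem legal_of_sorted (rec : ℕ → OpRec P K Op Ret) (val : K → S)
    (l : List ℕ) (hl : l.Pairwise fun i j => OpRec.rank rec i < OpRec.rank rec j) (c : K)
    (hc : ok c (val c)) (hle : ∀ i ∈ l, c ≤ (rec i).key)
    (hok : ∀ i ∈ l, ok (rec i).key (val (rec i).key))
    (heff : ∀ i ∈ l, (rec i).eff = true → ∀ c ≤ (rec i).key, ∀ s, ok c s →
      next s (rec i).op = val (rec i).key ∧ out s (rec i).op = (rec i).ret)
    (hobs : ∀ i ∈ l, (rec i).eff = false →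
      next (val (rec i).key) (rec i).op = val (rec i).key ∧
      out (val (rec i).key) (rec i).op = (rec i).ret)
    (hex : ∀ i ∈ l, (rec i).eff = false → (rec i).key = c ∨
      ∃ j ∈ l, (rec j).eff = true ∧ (rec j).key = (rec i).key) :
    Legal next out (val c) (l.map fun i => ((rec i).proc, (rec i).op, (rec i).ret)) := by
  induction l generalizing c with
  | nil => trivial
  | cons i l ih =>
    rw [List.pairwise_cons] at hl
    simp only [OpRec.rank_lt_iff] at hl
    simp only [List.mem_cons, forall_eq_or_imp, exists_eq_or_imp] at *
    have hk : ∀ j ∈ l, (rec i).key ≤ (rec j).key := fun j hj => by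
      rcases hl.1 j hj with h | h
      · exact h.le
      · exact h.1.le
    cases he : (rec i).eff
    -- An observer at the head must sit at the current key `c`: otherwise an effective operation in
    -- the list would have the same key and would be sorted before it.
    · have hci : (rec i).key = c := by
        rcases hex.1 he with h | h | ⟨j, hj, h1, h2⟩
        · exact h
        · simp [he] at h
        · have := hl.1 j hj
          simp [h1, h2, he] at this
      have h := hobs.1 he
      rw [hci] at h
      refine ⟨h.2.symm, ?_⟩
      rw [h.1]
      refine ih (by simpa only [OpRec.rank_lt_iff] using hl.2) c hc hle.2 hok.2 heff.2 hobs.2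
        fun j hj hje => ?_
      rcases hex.2 j hj hje with h | h | h
      · exact .inl h
      · simp [he] at h
      · exact .inr h
    -- An effective head may start from the admissible state at `c`, however many keys are skipped;
    -- afterwards its own key is the current one.
    · have h := heff.1 he c hle.1 _ hc
      refine ⟨h.2.symm, ?_⟩
      rw [h.1]
      refine ih (by simpa only [OpRec.rank_lt_iff] using hl.2) _ hok.1 hk hok.2 heff.2 hobs.2
        fun j hj hje => ?_
      rcases hex.2 j hj hje with h | h | h
      · exact .inl (le_antisymm (h ▸ hle.1) (hk j hj))
      · exact .inl h.2.symm
      · exact .inr h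

/-- The order of the events in the linearization. -/
def EventLT (rec : ℕ → OpRec P K Op Ret) (x y : ℕ × Bool) : Prop :=
  OpRec.rank rec x.1 < OpRec.rank rec y.1 ∨ x.1 = y.1 ∧ x.2 = false ∧ y.2 = true

theorem EventLT.asymm {rec : ℕ → OpRec P K Op Ret} {x y : ℕ × Bool} (h : EventLT rec x y) :
    ¬ EventLT rec y x := by
  rintro (h' | h') <;> rcases h with h | h
  · exact lt_asymm h h'
  · rw [h.1] at h'; exact lt_irrefl _ h'
  · rw [h'.1] at h; exact lt_irrefl _ h
  · simp [h.2.1] at h'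

theorem pairwise_opEvents (rec : ℕ → OpRec P K Op Ret) {l : List ℕ}
    (hl : l.Pairwise fun i j => OpRec.rank rec i < OpRec.rank rec j) :
    (opEvents l).Pairwise (EventLT rec) := by
  rw [opEvents, List.pairwise_flatMap]
  refine ⟨fun i _ => by simp [EventLT], hl.imp fun {i j} hij => ?_⟩
  simp [EventLT, hij]

/-- When no process is between commit and response, committed and completed operations coincide, so
dropping pending invocations leaves exactly the events of `C`. Sorting `C` by rank gives the
witness. -/
theorem Recorded.isLinearizable [DecidableEq P] {n : ℕ} {rec : ℕ → OpRec P K Op Ret}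
    {C : Finset ℕ} {H : List (ℕ × Bool)} {cur : P → ℕ}
    (R : Recorded next out ok k₀ s₀ n rec C H cur h a)
    (hcom : ∀ p u k, a.status p ≠ .committed u k) :
    ∃ s ∈ (Obj.ofMachine P s₀ next out).spec, IsReordering linRel (dropPending h) s := by
  have hres : ∀ i ∈ C, (i, true) ∈ H := by
    intro i hi
    have hin := R.lt_of_mem i hi
    rcases hs : a.status (rec i).proc with _ | ⟨o, f⟩ | ⟨u, k⟩
    · exact R.idle _ hs i hin rfl
    · by_contra hcon
      by_cases hic : i = cur (rec i).proc
      · exact (R.pending _ _ _ hs).1 (hic ▸ hi)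
      · exact hcon ((R.busy _ (by simp [hs])).2.2.2 i hin rfl hic).2
    · exact absurd hs (hcom _ _ _)
  -- Only the latest operation of a process can lack a response.
  have hprev : ∀ i j, i < j → j < n → (rec i).proc = (rec j).proc → (i, true) ∈ H := by
    intro i j hij hj hp
    by_cases hs : a.status (rec i).proc = .idle
    · exact R.idle _ hs i (hij.trans hj) rfl
    · obtain ⟨h1, h2, h3, h4⟩ := R.busy _ hs
      refine (h4 i (hij.trans hj) rfl ?_).2
      intro hic
      have := (h4 j hj hp.symm (by omega)).1
      omega
  have hCH : ∀ x ∈ H, (x.1 ∈ C ↔ (x.1, true) ∈ H) := fun x _ => ⟨hres _, R.mem_res _⟩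
  have hdrop : dropPending h = (H.filter fun x => x.1 ∈ C).map (recEvent rec) := by
    rw [R.hist]
    refine dropPending_map _ (fun x => x.1 ∈ C) H fun l₁ x l₂ hl => ?_
    have hord := R.order
    have hnd := R.nodup
    have hx : x ∈ H := by simp [hl]
    rw [hl, List.pairwise_append, List.pairwise_cons] at hord
    obtain ⟨i, b⟩ := x
    cases b
    · constructor
      · rintro hi ⟨_, hno⟩
        have hi' := hres _ hi
        rw [hl] at hi'
        simp only [List.mem_append, List.mem_cons, Prod.mk.injEq, Bool.true_eq_false, and_false,
          false_or] at hi'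
        rcases hi' with hi' | hi'
        · have := (hord.2.2 _ hi' (i, false) (by simp)).2.1 rfl rfl
          simp at this
        · exact hno _ hi' rfl
      · intro hno
        simp only [not_and, not_forall] at hno
        obtain ⟨y, hy, hyx⟩ := hno ⟨_, rfl⟩
        have hyx' : (rec i).proc = (rec y.1).proc := by
          simpa [recEvent] using (not_not.1 hyx).symm
        have hyH : y ∈ H := by simp [hl, hy]
        have hle := (hord.2.1.1 y hy).2.2 hyx'
        -- The later event of the process belongs either to a later operation, whose invocation
        -- required the response of `i`, or to `i` itself, and then it can only be that response.
        rcases lt_or_eq_of_le hle with h1 | h1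
        · exact R.mem_res _ (hprev _ _ h1 (R.lt_of_mem_hist hyH) hyx')
        · obtain ⟨j, b⟩ := y
          simp only at h1
          subst h1
          cases b
          · have := (hord.2.1.1 _ hy).1 rfl rfl
            simp at this
          · exact R.mem_res _ hyH
    · have : i ∈ C := R.mem_res i hx
      simp [this, IsInv, recEvent]
  let L : List ℕ := C.toList.insertionSort fun i j => OpRec.rank rec i ≤ OpRec.rank rec j
  have hLmem : ∀ i, i ∈ L ↔ i ∈ C := by simp [L]
  have : Std.Total fun i j => OpRec.rank rec i ≤ OpRec.rank rec j := ⟨fun i j => le_total _ _⟩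
  have : IsTrans ℕ fun i j => OpRec.rank rec i ≤ OpRec.rank rec j := ⟨fun i j k => le_trans⟩
  have hLnd : L.Nodup := (List.perm_insertionSort _ _).nodup_iff.2 C.nodup_toList
  have hL : L.Pairwise fun i j => OpRec.rank rec i < OpRec.rank rec j := by
    have h1 := List.pairwise_insertionSort (fun i j => OpRec.rank rec i ≤ OpRec.rank rec j) C.toList
    exact (h1.and hLnd).imp fun h => lt_of_le_of_ne h.1 ((OpRec.rank_injective rec).ne h.2)
  have hLE := pairwise_opEvents rec hL
  refine ⟨_, ⟨L.map fun i => ((rec i).proc, (rec i).op, (rec i).ret), ?_, rfl⟩, ?_⟩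
  · rw [← R.val_start]
    refine legal_of_sorted (ok := ok) rec a.val L hL k₀ (R.val_ok _ R.start_mem) ?_ ?_ ?_ ?_ ?_
      <;> simp only [hLmem]
    · exact fun i hi => R.start_le _ (R.key_mem i hi)
    · exact fun i hi => R.val_ok _ (R.key_mem i hi)
    · exact R.effect
    · exact R.observe
    · exact fun i hi _ => R.exists_eff _ (R.key_mem i hi)
  · rw [hdrop, ← map_opEvents]
    refine isReordering_of_pairwise (recEvent rec) (lt := EventLT rec) (fun _ _ => EventLT.asymm)
      (R.nodup.filter _) (hLE.imp fun {x y} h => ?_) ?_ hLE ?_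
    · rintro rfl
      exact h.asymm h
    · rintro ⟨i, b⟩
      simp only [List.mem_filter, decide_eq_true_eq, mem_opEvents, hLmem, and_iff_right_iff_imp]
      intro hi
      cases b
      · exact (R.mem_inv i).2 (R.lt_of_mem i hi)
      · exact hres i hi
    · have hrt : ∀ i j, i ∈ C → j ∈ C → RecOrder rec (i, true) (j, false) →
          OpRec.rank rec i < OpRec.rank rec j := by
        intro i j hi hj hij
        obtain ⟨h1, h2⟩ := hij.2.1 rfl rfl
        simp only at h1 h2
        rw [OpRec.rank_lt_iff]
        rcases lt_or_eq_of_le (h2.trans (R.floor_le j hj)) with h3 | h3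
        · exact .inl h3
        -- Equal keys force the floor of `j` up to its key, so `j` is an observer. Then `i` goes
        -- first, either as an effective operation or by its earlier invocation.
        · refine .inr ⟨h3, ?_⟩
          have hje : (rec j).eff = false := by
            by_contra hcon
            have := R.floor_lt j hj (by simpa using hcon)
            exact absurd (h3 ▸ h2) (not_le.2 this)
          cases hie : (rec i).eff
          · exact .inr ⟨hje.symm, h1⟩
          · exact .inl ⟨rfl, hje⟩
      -- One of two distinct events of `H` comes first, and the pairwise relation then holds in that
      -- direction.
      have hbefore : ∀ x ∈ H, ∀ y ∈ H, x ≠ y → ¬ RecOrder rec x y → RecOrder rec y x := by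
        intro x hx y hy hxy hno
        by_contra hcon
        have : ∀ l : List (ℕ × Bool), x ∈ l → y ∈ l → ¬ l.Pairwise (RecOrder rec) := by
          intro l
          induction l with
          | nil => simp
          | cons z l ih =>
            intro h1 h2 h3
            rw [List.pairwise_cons] at h3
            rcases List.mem_cons.1 h1 with rfl | h1'
            · rcases List.mem_cons.1 h2 with rfl | h2
              · exact hxy rfl
              · exact hno (h3.1 _ h2)
            · rcases List.mem_cons.1 h2 with rfl | h2
              · exact hcon (h3.1 _ h1')
              · exact ih h1' h2 h3.2
        exact this H hx hy R.order
      have hboth := ((R.order.and R.nodup).filter fun x => decide (x.1 ∈ C))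
      refine hboth.imp_of_mem fun {x y} hx hy hxy hrel => ?_
      simp only [List.mem_filter, decide_eq_true_eq] at hx hy
      obtain ⟨i, b⟩ := x
      obtain ⟨j, d⟩ := y
      rcases hrel with hrel | ⟨⟨u, hu⟩, ⟨o, ho⟩⟩
      · have hle := hxy.1.2.2 hrel
        rcases lt_or_eq_of_le hle with h1 | h1
        -- For two operations of one process the real-time argument applies as well: the invocation
        -- of `j` cannot stand before the response of `i`, since that would give `j ≤ i`.
        · refine .inl (hrt i j hx.2 hy.2 ?_)
          refine (hbefore (j, false) ?_ (i, true) (hres i hx.2) ?_ ?_)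
          · exact (R.mem_inv j).2 (R.lt_of_mem j hy.2)
          · simp
          · intro hc
            have := hc.2.2 hrel.symm
            simp only at this h1
            omega
        · simp only at h1
          subst h1
          refine .inr ⟨rfl, ?_⟩
          cases b <;> cases d
          · simp at hxy
          · simp
          · have := (hxy.1.2.1 rfl rfl).1
            simp at this
          · simp at hxy
      · cases b
        · simp [recEvent] at hu
        cases d
        · exact .inl (hrt i j hx.2 hy.2 hxy.1)
        · simp [recEvent] at ho

variable [DecidableEq P]

/-- Every history of a keyed machine can be completed. -/
theorem KReach.exists_completion [Finite P] (hr : KReach next out ok k₀ s₀ h a) :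
    ∃ (r : List (ObjEv P Op Ret)) (a' : KState P K Op Ret S), (∀ e ∈ r, IsRes e) ∧
      KReach next out ok k₀ s₀ (h ++ r) a' ∧ ∀ p u k, a'.status p ≠ .committed u k := by
  obtain ⟨m, hm⟩ : ∃ m, {p | ∃ u k, a.status p = .committed u k}.ncard = m := ⟨_, rfl⟩
  induction m generalizing h a with
  | zero =>
    rw [Set.ncard_eq_zero (Set.toFinite _)] at hm
    refine ⟨[], a, by simp, by simpa using hr, fun p u k hp => ?_⟩
    have : p ∈ (∅ : Set P) := hm ▸ ⟨u, k, hp⟩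
    exact this
  | succ m ih =>
    obtain ⟨p, hp⟩ : {p | ∃ u k, a.status p = .committed u k}.Nonempty := by
      rw [← Set.ncard_pos (Set.toFinite _)]; omega
    obtain ⟨u, k, hp'⟩ := hp
    obtain ⟨r, a', h1, h2, h3⟩ := ih (hr.res p u k hp') (by
      have : {q | ∃ v l, (Function.update a.status p Status.idle) q = .committed v l} =
          {p | ∃ u k, a.status p = .committed u k} \ {p} := by
        ext q
        by_cases hq : q = p
        · subst hq; simp
        · simp [hq]
      simp only [this]
      have := Set.ncard_sdiff_singleton_add_one (show p ∈ {p | ∃ u k, a.status p = .committed u k}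
        from ⟨u, k, hp'⟩) (Set.toFinite _)
      omega)
    refine ⟨(p, .res u) :: r, a', ?_, by simpa using h2, h3⟩
    simpa [IsRes] using h1

/-- Every history of a keyed machine is linearizable. -/
theorem KReach.isLinearizable [Finite P] [Nonempty Op] (hok : ok k₀ s₀)
    (hr : KReach next out ok k₀ s₀ h a) : IsLinearizable (Obj.ofMachine P s₀ next out) h := by
  obtain ⟨r, a', hres, hr', hcom⟩ := hr.exists_completion
  refine ⟨r, hres, hr'.wellFormed, ?_⟩
  rcases isEmpty_or_nonempty P with hP | hP
  · have : h ++ r = [] := by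
      rcases h ++ r with _ | ⟨e, _⟩
      · rfl
      · exact hP.elim e.1
    rw [this]
    exact ⟨[], ⟨[], trivial, rfl⟩, Equiv.refl _, fun i => rfl, fun i _ h _ => h⟩
  · obtain ⟨n, rec, C, H, cur, R⟩ := hr'.recorded hok
    exact R.isLinearizable hcom

end Keyed

end WMM

namespace WMM

variable {P Var Val Op Ret : Type}

/-! ### Runs -/

/-- A state invariant that may refer to the trace. -/
theorem LTS.Run.invariant {L : Type} {S : LTS L} {q₀ : S.State} (Φ : List L → S.State → Prop)
    (h₀ : Φ [] q₀) (hstep : ∀ π q l q', Φ π q → S.Tr q l q' → Φ (π ++ [l]) q')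
    {π : List L} {q : S.State} (h : S.Run q₀ π q) : Φ π q := by
  suffices H : ∀ {q' q : S.State} {π : List L}, S.Run q' π q → ∀ π₀, Φ π₀ q' → Φ (π₀ ++ π) q from
    H h [] h₀
  intro q' q π h
  induction h with
  | nil => simp
  | cons hs _ ih =>
    intro π₀ h
    simpa using ih _ (hstep _ _ _ _ h hs)

section Under

variable [DecidableEq P] {I : Impl P Var Val Op Ret} {M : MemModel P Var Val}

theorem run_silent {q : I.sys.State} {s s' : M.State} {n : ℕ}
    (h : M.Run s (List.replicate n none) s') :
    (I.under M).Run (q, s) (List.replicate n none) (q, s') := by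
  induction n generalizing s with
  | zero => cases h; exact .nil _
  | succ n ih =>
    cases h with
    | cons hs h => exact .cons (UnderStep.silent _ _ _ hs) (ih h)

theorem sys_update_self (q : I.sys.State) (p : P) (r : Option (Σ o : Op, (I o p).State)) :
    Function.update q p r p = r := Function.update_self ..

theorem sys_update_of_ne (q : I.sys.State) {p p' : P} (h : p ≠ p')
    (r : Option (Σ o : Op, (I o p').State)) : Function.update q p' r p = q p :=
  Function.update_of_ne h ..

/-- A trace of the system whose memory events are an observable trace of the memory is a trace of
the system on top of the memory. -/
theorem exists_under_run {q q' : I.sys.State} {π : List (Event P Var Val Op Ret)}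
    (h : I.sys.Run q π q') {s s' : M.State} {ρ : List (Option (MemEv P Var Val))}
    (hρ : M.Run s ρ s') (hπ : ρ.reduceOption = memPart π) :
    ∃ ρ', (I.under M).Run (q, s) ρ' (q', s') ∧ ρ'.reduceOption = π := by
  -- Silent steps advance only the memory and object events only the processes. Hence the outer
  -- induction runs over the memory, and an inner one skips object events until the next memory
  -- event.
  induction hρ generalizing q π with
  | nil s =>
    induction h with
    | nil q => exact ⟨[], .nil _, rfl⟩
    | @cons q q' q'' e π hs _ ih =>
      rcases e with e | e
      · simp [memPart] at hπ
      · obtain ⟨ρ', h1, h2⟩ := ih (by simpa [memPart] using hπ)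
        exact ⟨some (.inr e) :: ρ', .cons (UnderStep.obj _ _ _ _ hs) h1, by simp [h2]⟩
  | @cons s s₁ s₂ l ρ hl hρ ih =>
    rcases l with _ | e
    · obtain ⟨ρ', h1, h2⟩ := ih h (by simpa using hπ)
      exact ⟨none :: ρ', .cons (UnderStep.silent _ _ _ hl) h1, by simpa using h2⟩
    · clear hρ
      induction h with
      | nil q => simp [memPart] at hπ
      | @cons q q₁ q₂ e' π hs h ih' =>
        rcases e' with e' | e'
        · simp only [List.reduceOption_cons_of_some, memPart, List.filterMap_cons,
            Sum.getLeft?_inl, List.cons.injEq] at hπ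
          obtain ⟨ρ', h1, h2⟩ := ih h hπ.2
          exact ⟨some (.inl e') :: ρ', .cons (UnderStep.mem _ _ _ _ _ hs (hπ.1 ▸ hl)) h1,
            by simp [h2]⟩
        · obtain ⟨ρ', h1, h2⟩ := ih' ih hπ
          exact ⟨some (.inr e') :: ρ', .cons (UnderStep.obj _ _ _ _ hs) h1, by simp [h2]⟩

/-- The memory component of a run. -/
theorem exists_mem_run {c c' : (I.under M).State} {π : List (Option (Event P Var Val Op Ret))}
    (h : (I.under M).Run c π c') : ∃ ρ, M.Run (Prod.snd c) ρ (Prod.snd c') := by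
  induction h with
  | nil => exact ⟨[], .nil _⟩
  | cons hs _ ih =>
    obtain ⟨ρ, hρ⟩ := ih
    cases hs with
    | silent q s s' h => exact ⟨_, .cons h hρ⟩
    | mem q q' s s' e _ h => exact ⟨_, .cons h hρ⟩
    | obj q q' s e h => exact ⟨ρ, hρ⟩

/-! ### Linearizability by simulation -/

/-- An implementation is linearizable if it is simulated by a keyed machine. The relation `Sim`
holds for the states of processes and memory and for a state of the machine. -/
theorem linearizable_of_simulation {K S : Type} [LinearOrder K] [Finite P] [Nonempty Op]
    {next : S → Op → S} {out : S → Op → Ret} (ok : K → S → Prop) (k₀ : K) {s₀ : S} (hok : ok k₀ s₀)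
    (Sim : ((p : P) → Option (Σ o : Op, (I o p).State)) → M.State → KState P K Op Ret S → Prop)
    (start : Sim (fun _ => none) M.start ⟨fun _ => .idle, k₀, {k₀}, fun _ => s₀⟩)
    (silent : ∀ q s s' h a, KReach next out ok k₀ s₀ h a → Sim q s a → M.Tr s none s' →
      ∃ a', KReach next out ok k₀ s₀ h a' ∧ Sim q s' a')
    (inv : ∀ q s h a p o, KReach next out ok k₀ s₀ h a → Sim q s a → q p = none →
      ∃ a', KReach next out ok k₀ s₀ (h ++ [(p, .inv o)]) a' ∧
        Sim (Function.update q p (some ⟨o, (I o p).start⟩)) s a')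
    (mem : ∀ q s s' h a p o x x' e, KReach next out ok k₀ s₀ h a → Sim q s a → q p = some ⟨o, x⟩ →
      (I o p).Tr x (.inl (p, e)) x' → M.Tr s (some (p, e)) s' →
      ∃ a', KReach next out ok k₀ s₀ h a' ∧ Sim (Function.update q p (some ⟨o, x'⟩)) s' a')
    (res : ∀ q s h a p o x x' u, KReach next out ok k₀ s₀ h a → Sim q s a → q p = some ⟨o, x⟩ →
      (I o p).Tr x (.inr (p, .res u)) x' →
      ∃ a', KReach next out ok k₀ s₀ (h ++ [(p, .res u)]) a' ∧ Sim (Function.update q p none) s a') :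
    Linearizable (Obj.ofMachine P s₀ next out) I M := by
  rintro h ⟨π, ⟨q, hq⟩, ⟨ρ, ⟨s, hs⟩, hρ⟩, rfl⟩
  obtain ⟨ρ', h1, rfl⟩ := exists_under_run hq hs hρ
  have key := h1.invariant (fun π (c : I.sys.State × M.State) => ∃ a,
    KReach next out ok k₀ s₀ (objPart π.reduceOption) a ∧ Sim c.1 c.2 a)
    ⟨_, .init, start⟩ ?_
  · obtain ⟨a, ha, _⟩ := key
    exact ha.isLinearizable hok
  · rintro π c l c' ⟨a, ha, hsim⟩ hstep
    cases hstep with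
    | silent q s s' h =>
      have h1 : (π ++ [none]).reduceOption = π.reduceOption := by simp [List.reduceOption_append]
      rw [h1]
      exact silent q s s' _ a ha hsim h
    | mem q q' s s' e h hm =>
      obtain ⟨p, r, hp, rfl⟩ := h
      generalize hqp : q p = qp at hp
      cases hp with
      | mem o x x' e hx =>
        have he : e.1 = p := (I o p).tr_proc _ _ _ hx
        obtain ⟨p', e⟩ := e
        simp only at he
        subst he
        have h1 : objPart (π ++ [some (Sum.inl (p', e) : Event P Var Val Op Ret)]).reduceOption = objPart π.reduceOption := by
          rw [List.reduceOption_append, objPart, List.filterMap_append]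
          exact List.append_nil _
        rw [h1]
        exact mem q s s' _ a _ o x x' e ha hsim hqp hx hm
    | obj q q' s e h =>
      obtain ⟨p, r, hp, rfl⟩ := h
      generalize hqp : q p = qp at hp
      cases hp with
      | inv o =>
        simpa [List.reduceOption_append, objPart] using inv q s _ a p o ha hsim hqp
      | res o x x' u hx =>
        simpa [List.reduceOption_append, objPart] using res q s _ a p o x x' u ha hsim hqp hx

/-! ### Wait-freedom -/

/-- In every reachable state, possibly after silent steps, a process can write, read every variable
and perform a fence. -/
def Responsive (M : MemModel P Var Val) : Prop :=
  ∀ ρ s, M.Run M.start ρ s → ∀ p, ∃ n s', M.Run s (List.replicate n none) s' ∧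
    (∀ x v, ∃ s'', M.Tr s' (some (p, .W x v)) s'') ∧
    (∀ x, ∃ v s'', M.Tr s' (some (p, .R x v)) s'') ∧
    ∃ s'', M.Tr s' (some (p, .F)) s''

/-- The actions that are always possible in a responsive memory, and responses. -/
def CanStep {p : P} (A : OpImpl Var Val Op Ret p) (x : A.State) : Prop :=
  (∃ u x', A.Tr x (.inr (p, .res u)) x') ∨ (∃ y v x', A.Tr x (.inl (p, .W y v)) x') ∨
    (∃ y v x', A.Tr x (.inl (p, .R y v)) x') ∨ ∃ x', A.Tr x (.inl (p, .F)) x'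

/-- Steps of other processes and of the memory leave the control state of `p` alone, so infinitely
many own steps without a response would make `rank` descend forever. The predicate `live` excludes
control states without transitions, such as those after the response. -/
theorem waitFree_of_rank (hM : Responsive M)
    (rank : ∀ o p, (I o p).State → ℕ)
    (hrank : ∀ o p x e x', (I o p).Tr x e x' → rank o p x' < rank o p x)
    (live : ∀ o p, (I o p).State → Prop)
    (hstart : ∀ o p, live o p (I o p).start)
    (hlive : ∀ o p x e x', live o p x → (I o p).Tr x (.inl e) x' → live o p x')
    (hcan : ∀ o p x, live o p x → CanStep (I o p) x)
    (haccepts : ∀ o p q x v q', (I o p).Tr q (.inl (p, .R x v)) q' →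
      ∀ v', ∃ q'', (I o p).Tr q (.inl (p, .R x v')) q'') : WaitFree I M where
  accepts := haccepts
  terminates := by
    intro c l hrun p hinf n
    by_contra hcon
    push Not at hcon
    let r : ℕ → ℕ := fun k => ((c k).1 p).elim 0 fun x => rank x.1 p x.2
    -- effect of a single step on `p`
    have hstep : ∀ k, n ≤ k →
        (¬ IsStepOf p (l k) ∧ (c (k + 1)).1 p = (c k).1 p) ∨
        (IsStepOf p (l k) ∧ (c k).1 p = none ∧ (c (k + 1)).1 p ≠ none) ∨
        (IsStepOf p (l k) ∧ (c k).1 p ≠ none ∧ (c (k + 1)).1 p ≠ none ∧ r (k + 1) < r k) := by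
      intro k hk
      have hs := hrun.2 k
      have hno := hcon k hk
      simp only [r]
      generalize c k = ck at hs ⊢
      generalize c (k + 1) = ck' at hs ⊢
      generalize l k = lk at hs hno ⊢
      cases hs with
      | silent q s s' h => exact .inl ⟨by simp [IsStepOf], rfl⟩
      | mem q q' s s' e h hm =>
        obtain ⟨p', x, hp, rfl⟩ := h
        generalize hqp : q p' = qp at hp
        cases hp with
        | mem o y y' e hy =>
          have he : e.1 = p' := (I o p').tr_proc _ _ _ hy
          by_cases hpp : p' = p
          · subst hpp
            exact .inr (.inr ⟨⟨_, rfl, he⟩, by simp [hqp], by simp [sys_update_self],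
              by simpa [hqp, sys_update_self] using hrank _ _ _ _ _ hy⟩)
          · refine .inl ⟨?_, by exact sys_update_of_ne q (Ne.symm hpp) _⟩
            rintro ⟨e', h1, h2⟩
            cases h1
            exact hpp (he.symm.trans h2)
      | obj q q' s e h =>
        obtain ⟨p', x, hp, rfl⟩ := h
        generalize hqp : q p' = qp at hp
        by_cases hpp : p' = p
        · subst hpp
          cases hp with
          | inv o => exact .inr (.inl ⟨⟨_, rfl, rfl⟩, hqp, by simp [sys_update_self]⟩)
          | res o y y' u hy => exact absurd ⟨u, rfl⟩ hno
        · refine .inl ⟨?_, by exact sys_update_of_ne q (Ne.symm hpp) _⟩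
          rintro ⟨e', h1, h2⟩
          cases h1
          cases hp <;> exact hpp h2
    have hbusy : ∀ k, n ≤ k → (c k).1 p ≠ none → ∀ j, (c (k + j)).1 p ≠ none := by
      intro k hk h j
      induction j with
      | zero => exact h
      | succ j ih =>
        rcases hstep (k + j) (by omega) with h' | h' | h'
        · rw [← add_assoc, h'.2]; exact ih
        · exact h'.2.2
        · exact h'.2.2.1
    have hdesc : ∀ m k, n ≤ k → (c k).1 p ≠ none → r k ≤ m → False := by
      intro m
      induction m using Nat.strong_induction_on with
      | _ m ih =>
        intro k hk hb hr
        have hle : ∀ j, r (k + j) ≤ r k := by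
          intro j
          induction j with
          | zero => exact le_rfl
          | succ j ihj =>
            rcases hstep (k + j) (by omega) with h' | h' | h'
            · have : r (k + j + 1) = r (k + j) := by simp only [r, h'.2]
              rw [← add_assoc, this]; exact ihj
            · exact absurd h'.2.1 (hbusy k hk hb j)
            · exact (h'.2.2.2.le).trans ihj
        obtain ⟨k', hkk', hk'⟩ := hinf k
        obtain ⟨j, rfl⟩ := Nat.exists_eq_add_of_le hkk'
        rcases hstep (k + j) (by omega) with h' | h' | h'
        · exact h'.1 hk'
        · exact hbusy k hk hb j h'.2.1
        · exact ih (r (k + j + 1)) (lt_of_lt_of_le h'.2.2.2 ((hle j).trans hr)) (k + j + 1)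
            (by omega) h'.2.2.1 le_rfl
    obtain ⟨k, hk, hks⟩ := hinf n
    rcases hstep k hk with h' | h' | h'
    · exact h'.1 hks
    · exact hdesc _ (k + 1) (by omega) h'.2.2 le_rfl
    · exact hdesc _ (k + 1) (by omega) h'.2.2.1 le_rfl
  not_stuck := by
    intro π c hrun p hp
    have hl : ∀ p x, c.1 p = some x → live x.1 p x.2 := by
      refine hrun.invariant (fun _ (c : I.sys.State × M.State) => ∀ p x, c.1 p = some x → live x.1 p x.2) ?_ ?_
      · intro p x h
        cases h
      · intro _ c l c' ih hs p x hx
        cases hs with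
        | silent q s s' h => exact ih p x hx
        | mem q q' s s' e h hm =>
          obtain ⟨p', y, hp, rfl⟩ := h
          generalize hqp : q p' = qp at hp
          by_cases hpp : p = p'
          · subst hpp
            cases hp with
            | mem o y y' e hy =>
              simp only [sys_update_self, Option.some.injEq] at hx
              subst hx
              exact hlive _ _ _ _ _ (ih p ⟨o, y⟩ hqp) hy
          · exact ih p x (by simpa only [sys_update_of_ne q hpp] using hx)
        | obj q q' s e h =>
          obtain ⟨p', y, hp, rfl⟩ := h
          by_cases hpp : p = p'
          · subst hpp
            generalize hqp : q p = qp at hp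
            cases hp with
            | inv o =>
              simp only [sys_update_self, Option.some.injEq] at hx
              subst hx
              exact hstart o p
            | res o y y' u hy => simp [sys_update_self] at hx
          · exact ih p x (by simpa only [sys_update_of_ne q hpp] using hx)
    obtain ⟨⟨o, x⟩, hx⟩ := Option.ne_none_iff_exists'.1 hp
    obtain ⟨q, s⟩ := c
    simp only at hx
    obtain ⟨ρ, hρ⟩ := exists_mem_run hrun
    obtain ⟨n, s', hn, hW, hR, hF⟩ := hM ρ s hρ p
    have hmem : ∀ a x' s'', (I o p).Tr x (.inl (p, a)) x' → M.Tr s' (some (p, a)) s'' →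
        ∃ n c' l c'', (I.under M).Run (q, s) (List.replicate n none) c' ∧
          (I.under M).Tr c' l c'' ∧ IsStepOf p l := fun a x' s'' h1 h2 =>
      ⟨n, _, _, (_, s''), run_silent hn,
        UnderStep.mem q _ s' s'' (p, a) ⟨p, _, by rw [hx]; exact .mem o x x' _ h1, rfl⟩ h2,
        _, rfl, rfl⟩
    rcases hcan o p x (hl p _ hx) with ⟨u, x', h⟩ | ⟨y, v, x', h⟩ | ⟨y, v, x', h⟩ | ⟨x', h⟩
    · exact ⟨0, _, _, _, .nil _,
        UnderStep.obj q _ s (p, .res u) ⟨p, _, by rw [hx]; exact .res o x x' u h, rfl⟩,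
        _, rfl, rfl⟩
    · obtain ⟨s'', hs⟩ := hW y v
      exact hmem _ _ _ h hs
    · obtain ⟨v', s'', hs⟩ := hR y
      -- The memory dictates the value read, which need not be the one in the transition at hand.
      obtain ⟨x'', h'⟩ := haccepts _ _ _ _ _ _ h v'
      exact hmem _ _ _ h' hs
    · obtain ⟨s'', hs⟩ := hF
      exact hmem _ _ _ h hs

end Under

/-! ### Placement of fences -/

/-- The phases of an operation: before the first fence, between the fences, and after the last
one. -/
inductive Phase : Type
  | before
  | body
  | after

/-- The placement of fences follows from a description of the phases. -/
theorem fenceShape_of_phase {p : P} (A : OpImpl Var Val Op Ret p) (i j : ℕ) (hi : i ≤ 1)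
    (ph : A.State → Phase) (hstart : ph A.start = if i = 0 then .body else .before)
    (hmem : ∀ x e x', A.Tr x (.inl (p, e)) x' →
      (ph x = .before ∧ e = .F ∧ ph x' = .body) ∨
      (ph x = .body ∧ e.IsRW ∧ ph x' = .body) ∨
      (ph x = .body ∧ e = .F ∧ j = 1 ∧ ph x' = .after))
    (hobj : ∀ x e x', A.Tr x (.inr e) x' →
      (ph x = .after ∨ ph x = .body ∧ j = 0) ∧ ph x' = ph x) :
    FenceShape A i j := by
  -- An operation without closing fence (`j = 0`) responds in the phase `body` and stays there,
  -- which is why the middle clause tolerates a response.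
  have key : ∀ π x, A.Run A.start π x → ∃ σ : List (MemEv P Var Val), (∀ e ∈ σ, e.2.IsRW) ∧
      ((ph x = .before ∧ i = 1 ∧ memPart π = [] ∧ ∀ e ∈ objPart π, ¬ IsRes e) ∨
      (ph x = .body ∧ memPart π = List.replicate i (p, .F) ++ σ ∧
        ((∃ e ∈ objPart π, IsRes e) → j = 0)) ∨
      (ph x = .after ∧
        memPart π = List.replicate i (p, .F) ++ σ ++ List.replicate j (p, .F))) := by
    intro π x h
    refine h.invariant (fun π x => ∃ σ : List (MemEv P Var Val), (∀ e ∈ σ, e.2.IsRW) ∧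
      ((ph x = .before ∧ i = 1 ∧ memPart π = [] ∧ ∀ e ∈ objPart π, ¬ IsRes e) ∨
      (ph x = .body ∧ memPart π = List.replicate i (p, .F) ++ σ ∧
        ((∃ e ∈ objPart π, IsRes e) → j = 0)) ∨
      (ph x = .after ∧
        memPart π = List.replicate i (p, .F) ++ σ ++ List.replicate j (p, .F)))) ?_ ?_
    · refine ⟨[], by simp, ?_⟩
      rcases Nat.le_one_iff_eq_zero_or_eq_one.1 hi with rfl | rfl
      · exact .inr (.inl ⟨by simpa using hstart, rfl, by simp [objPart]⟩)
      · exact .inl ⟨by simpa using hstart, rfl, rfl, by simp [objPart]⟩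
    · rintro π x e x' ⟨σ, hσ, ih⟩ hs
      rcases e with ⟨p', e⟩ | e
      · obtain rfl : p' = p := A.tr_proc _ _ _ hs
        have h1 : memPart (π ++ [Sum.inl (p', e)]) = memPart π ++ [(p', e)] := by simp [memPart]
        have h2 : objPart (π ++ [Sum.inl (p', e)]) = objPart π := by simp [objPart]
        rw [h1, h2]
        rcases hmem _ _ _ hs with ⟨ha, rfl, hb⟩ | ⟨ha, he, hb⟩ | ⟨ha, rfl, rfl, hb⟩
        · simp only [ha, reduceCtorEq, false_and, or_false, true_and] at ih
          obtain ⟨rfl, h3, h4⟩ := ih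
          exact ⟨[], by simp, .inr (.inl ⟨hb, by simp [h3], fun ⟨e, he, he'⟩ =>
            absurd he' (h4 e he)⟩)⟩
        · simp only [ha, reduceCtorEq, false_and, or_false, true_and, false_or] at ih
          refine ⟨σ ++ [(p', e)], ?_, .inr (.inl ⟨hb, by simp [ih.1], ih.2⟩)⟩
          intro e' he'
          rcases List.mem_append.1 he' with h | h
          · exact hσ _ h
          · rw [List.mem_singleton.1 h]; exact he
        · simp only [ha, reduceCtorEq, false_and, or_false, true_and, false_or] at ih
          exact ⟨σ, hσ, .inr (.inr ⟨hb, by simp [ih.1]⟩)⟩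
      · obtain ⟨h1, h2⟩ := hobj _ _ _ hs
        have h3 : memPart (π ++ [Sum.inr e]) = memPart π := by simp [memPart]
        rw [h2, h3]
        refine ⟨σ, hσ, ?_⟩
        rcases h1 with h1 | ⟨h1, hj⟩
        · simpa [h1] using ih
        · simp only [h1, reduceCtorEq, false_and, or_false, true_and, false_or] at ih ⊢
          exact ⟨ih.1, fun _ => hj⟩
  rintro π ⟨x, h⟩
  obtain ⟨σ, hσ, h⟩ := key π x h
  rcases h with ⟨_, rfl, h1, h2⟩ | ⟨_, h1, h2⟩ | ⟨_, h1⟩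
  · exact ⟨[], by simp, by simp [h1], fun ⟨e, he, he'⟩ => absurd he' (h2 e he)⟩
  · refine ⟨σ, hσ, by simp [h1], fun h => ?_⟩
    simp [h1, h2 h]
  · exact ⟨σ, hσ, by simp [h1], fun _ => h1⟩

end WMM

namespace WMM

variable {P Var Val : Type}

/-! ### The memory models -/

/-- Silent steps can drain the buffer of `p`, after which fences are enabled and reads go to the
main memory. -/
theorem tso_responsive [DecidableEq P] [DecidableEq Var] [Zero Val] :
    Responsive (TSO P Var Val) := by
  rintro - ⟨m, b⟩ - p
  suffices H : ∃ n m' b', (TSO P Var Val).Run (m, b) (List.replicate n none) (m', b') ∧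
      b' p = [] by
    obtain ⟨n, m', b', h, hb⟩ := H
    exact ⟨n, (m', b'), h, fun x v => ⟨_, TSOStep.write _ _ _ _ _⟩,
      fun x => ⟨_, _, TSOStep.readMemory _ _ _ _ _ (by simp [hb]) rfl⟩,
      ⟨_, TSOStep.fence _ _ _ hb⟩⟩
  obtain ⟨l, hl⟩ : ∃ l, b p = l := ⟨_, rfl⟩
  induction l generalizing m b with
  | nil => exact ⟨0, m, b, .nil _, hl⟩
  | cons e l ih =>
    obtain ⟨n, m', b', h, hb⟩ := ih (Function.update m e.1 e.2) (Function.update b p l) (by simp)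
    exact ⟨n + 1, m', b', .cons (TSOStep.propagate m b p e.1 e.2 l hl) h, hb⟩

/-! ### Views and timestamps of release/acquire. -/

/-- Every timestamp of the view belongs to a message. -/
def Populated (m : Set (Msg Var Val)) (V : Var → ℕ) : Prop :=
  ∀ x, ∃ μ ∈ m, μ.var = x ∧ μ.time = V x

theorem Populated.mono {m m' : Set (Msg Var Val)} {V : Var → ℕ} (h : Populated m V)
    (hm : m ⊆ m') : Populated m' V := fun x =>
  let ⟨μ, h1, h2⟩ := h x
  ⟨μ, hm h1, h2⟩

theorem Populated.sup {m : Set (Msg Var Val)} {V V' : Var → ℕ} (h : Populated m V)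
    (h' : Populated m V') : Populated m (V ⊔ V') := by
  intro x
  rcases le_total (V x) (V' x) with hx | hx
  · simpa [Pi.sup_apply, hx] using h' x
  · simpa [Pi.sup_apply, hx] using h x

/-- An invariant of release/acquire: all views are populated, and the timestamps are bounded. -/
structure RAState.WellFormed (s : RAState P Var Val) : Prop where
  view : ∀ p, Populated s.mem (s.view p)
  fview : Populated s.mem s.fview
  msg : ∀ μ ∈ s.mem, Populated s.mem μ.view
  bounded : ∀ x, ∃ B, ∀ μ ∈ s.mem, μ.var = x → μ.time ≤ B

variable [DecidableEq P] [DecidableEq Var]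

theorem Populated.update {m : Set (Msg Var Val)} {V : Var → ℕ} (h : Populated m V) (μ : Msg Var Val)
    (hμ : μ ∈ m) : Populated m (Function.update V μ.var μ.time) := by
  intro x
  by_cases hx : x = μ.var
  · subst hx
    exact ⟨μ, hμ, rfl, by simp⟩
  · simpa [hx] using h x

theorem RAState.WellFormed.add {m : Set (Msg Var Val)} {V : P → Var → ℕ} {Vf : Var → ℕ}
    (h : (RAState.mk m V Vf).WellFormed) (p : P) (x : Var) (v : Val) (t : ℕ) :
    (RAState.mk (m ∪ {⟨x, v, t, Function.update (V p) x t⟩})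
      (Function.update V p (Function.update (V p) x t)) Vf).WellFormed := by
  have hsub : m ⊆ m ∪ {⟨x, v, t, Function.update (V p) x t⟩} := Set.subset_union_left
  have hnew : Populated (m ∪ {⟨x, v, t, Function.update (V p) x t⟩}) (Function.update (V p) x t) :=
    ((h.view p).mono hsub).update ⟨x, v, t, Function.update (V p) x t⟩ (by simp)
  refine ⟨fun q => ?_, h.fview.mono hsub, ?_, fun y => ?_⟩
  · by_cases hq : q = p
    · subst hq; simpa using hnew
    · simpa [hq] using (h.view q).mono hsub
  · rintro μ (hμ | rfl)
    · exact (h.msg μ hμ).mono hsub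
    · exact hnew
  · obtain ⟨B, hB⟩ := h.bounded y
    refine ⟨max B t, ?_⟩
    rintro μ (hμ | rfl) hy
    · exact (hB μ hμ hy).trans (le_max_left _ _)
    · exact le_max_right _ _

theorem RAState.WellFormed.step {s s' : RAState P Var Val} {l : Option (MemEv P Var Val)}
    (h : s.WellFormed) (hs : RAStep s l s') : s'.WellFormed := by
  cases hs with
  | write m V Vf p x v t _ _ => exact h.add p x v t
  | read => exact h
  | rmw m V Vf p x _ v U _ _ => exact h.add p x v _
  | fence m V Vf p =>
    have hnew := (h.view p).sup h.fview
    refine ⟨fun q => ?_, hnew, h.msg, h.bounded⟩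
    by_cases hq : q = p
    · subst hq; simpa using hnew
    · simpa [hq] using h.view q
  | propagate m V Vf p μ hμ _ =>
    refine ⟨fun q => ?_, h.fview, h.msg, h.bounded⟩
    by_cases hq : q = p
    · subst hq; simpa using (h.view q).sup (h.msg μ hμ)
    · simpa [hq] using h.view q

variable [Zero Val]

theorem RA_start_wellFormed : RAState.WellFormed (RA P Var Val).start := by
  have h : Populated (RA P Var Val).start.mem fun _ => 0 := fun x => ⟨_, ⟨x, rfl⟩, rfl, rfl⟩
  refine ⟨fun _ => h, h, ?_, fun x => ⟨0, ?_⟩⟩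
  · rintro μ ⟨x, rfl⟩
    exact h
  · rintro μ ⟨x, rfl⟩ _
    exact le_rfl

/-- No silent step is needed: the populated view provides a message to read, and boundedness leaves
room for a fresh timestamp above all others. -/
theorem ra_responsive : Responsive (RA P Var Val) := by
  intro ρ s hs p
  have hwf : RAState.WellFormed s := hs.invariant (fun _ s => RAState.WellFormed s)
    RA_start_wellFormed fun _ _ _ _ h hs => h.step hs
  obtain ⟨m, V, Vf⟩ := s
  refine ⟨0, _, .nil _, fun x v => ?_, fun x => ?_, ⟨_, RAStep.fence _ _ _ _⟩⟩
  · obtain ⟨B, hB⟩ := hwf.bounded x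
    refine ⟨_, RAStep.write m V Vf p x v (max (V p x) B + 1) ?_ ?_⟩
    · have := le_max_left (V p x) B
      omega
    · intro μ hμ hx
      have h1 := hB μ hμ hx
      have h2 := le_max_right (V p x) B
      omega
  · obtain ⟨⟨y, v, t, U⟩, hμ, rfl, ht⟩ := hwf.view p x
    simp only at ht
    subst ht
    exact ⟨v, _, RAStep.read _ _ _ _ _ _ _ hμ⟩

end WMM

namespace WMM

variable {P Var Val : Type}

/-! ### Registers -/

instance (α : Type) : Nonempty (RegOp α) := ⟨.read⟩

/-- Control states of the register implementations, which access a single shared variable. -/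
inductive RegState (Val : Type) : Type
  | begin
  | body
  | tail (u : RegRet Val)
  | returning (u : RegRet Val)
  | finished

/-- The number of steps that remain. -/
def RegState.rank {Val : Type} : RegState Val → ℕ
  | .begin => 4
  | .body => 3
  | .tail _ => 2
  | .returning _ => 1
  | .finished => 0

/-- `write(a)`: fence; `x := a`; fence; return `ack`. `read()`: fence; `v := x`; fence;
return `v`. -/
inductive FencedRegStep {A : Set Val} (x : Var) (o : RegOp A) (p : P) :
    RegState Val → Event P Var Val (RegOp A) (RegRet Val) → RegState Val → Prop
  | fence₁ : FencedRegStep x o p .begin (.inl (p, .F)) .body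
  | write (a : A) : o = .write a → FencedRegStep x o p .body (.inl (p, .W x a)) (.tail .ack)
  | read (v : Val) : o = .read → FencedRegStep x o p .body (.inl (p, .R x v)) (.tail (.val v))
  | fence₂ (u : RegRet Val) : FencedRegStep x o p (.tail u) (.inl (p, .F)) (.returning u)
  | respond (u : RegRet Val) :
      FencedRegStep x o p (.returning u) (.inr (p, .res u)) .finished

/-- `write(a)`: `x := a`; fence; return `ack`. `read()`: `v := x`; return `v`. -/
inductive PlainRegStep {A : Set Val} (x : Var) (o : RegOp A) (p : P) :
    RegState Val → Event P Var Val (RegOp A) (RegRet Val) → RegState Val → Prop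
  | write (a : A) : o = .write a → PlainRegStep x o p .body (.inl (p, .W x a)) (.tail .ack)
  | read (v : Val) : o = .read → PlainRegStep x o p .body (.inl (p, .R x v)) (.returning (.val v))
  -- The premise removes the fence from the LTS of `read` even in unreachable states, so a constant
  -- phase suffices for the fence placement of `read`.
  | fence (a : A) (u : RegRet Val) :
      o = .write a → PlainRegStep x o p (.tail u) (.inl (p, .F)) (.returning u)
  | respond (u : RegRet Val) :
      PlainRegStep x o p (.returning u) (.inr (p, .res u)) .finished

/-- The register with fences around both operations. -/
def fencedReg (P : Type) (A : Set Val) (x : Var) : Impl P Var Val (RegOp A) (RegRet Val) :=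
  fun o p =>
  { State := RegState Val
    start := .begin
    Tr := FencedRegStep x o p
    tr_proc := by
      intro q e q' h
      cases h <;> rfl
    tr_res := by
      intro q u q' h e q'' h'
      cases h
      cases h' }

/-- The register with a fence after writes. -/
def plainReg (P : Type) (A : Set Val) (x : Var) : Impl P Var Val (RegOp A) (RegRet Val) :=
  fun o p =>
  { State := RegState Val
    start := .body
    Tr := PlainRegStep x o p
    tr_proc := by
      intro q e q' h
      cases h <;> rfl
    tr_res := by
      intro q u q' h e q'' h'
      cases h
      cases h' }

/-! ### Wait-freedom and fence placement of the registers. -/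

theorem fencedReg_waitFree [DecidableEq P] [Nonempty Val] (A : Set Val) (x : Var)
    {M : MemModel P Var Val} (hM : Responsive M) : WaitFree (fencedReg P A x) M := by
  refine waitFree_of_rank hM (fun _ _ => RegState.rank) ?_ (fun _ _ s => s ≠ .finished) ?_ ?_ ?_ ?_
  · intro o p y e y' h
    cases h <;> simp [RegState.rank]
  · rintro o p ⟨⟩
  · intro o p y e y' _ h
    cases h <;> exact nofun
  · intro o p y hy
    cases y with
    | begin => exact .inr (.inr (.inr ⟨_, FencedRegStep.fence₁⟩))
    | body =>
      cases o with
      | write a => exact .inr (.inl ⟨_, _, _, FencedRegStep.write a rfl⟩)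
      | read =>
        obtain ⟨v⟩ := ‹Nonempty Val›
        exact .inr (.inr (.inl ⟨_, _, _, FencedRegStep.read v rfl⟩))
    | tail u => exact .inr (.inr (.inr ⟨_, FencedRegStep.fence₂ u⟩))
    | returning u => exact .inl ⟨_, _, FencedRegStep.respond u⟩
    | finished => exact absurd rfl hy
  · intro o p y z v y' h v'
    cases h with
    | read _ h => exact ⟨_, FencedRegStep.read v' h⟩

theorem plainReg_waitFree [DecidableEq P] [Nonempty Val] (A : Set Val) (x : Var)
    {M : MemModel P Var Val} (hM : Responsive M) : WaitFree (plainReg P A x) M := by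
  refine waitFree_of_rank hM (fun _ _ => RegState.rank) ?_
    -- The plain register starts in `body`, and its `read` goes directly to `returning`.
    (fun o _ s => s ≠ .finished ∧ s ≠ .begin ∧ (o = .read → ∀ u, s ≠ .tail u)) ?_ ?_ ?_ ?_
  · intro o p y e y' h
    cases h <;> simp [RegState.rank]
  · intro o p
    simp [plainReg]
  · intro o p y e y' _ h
    cases h with
    | write a ho => exact ⟨nofun, nofun, by simp [ho]⟩
    | _ => exact ⟨nofun, nofun, nofun⟩
  · intro o p y hy
    cases y with
    | begin => exact absurd rfl hy.2.1
    | body =>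
      cases o with
      | write a => exact .inr (.inl ⟨_, _, _, PlainRegStep.write a rfl⟩)
      | read =>
        obtain ⟨v⟩ := ‹Nonempty Val›
        exact .inr (.inr (.inl ⟨_, _, _, PlainRegStep.read v rfl⟩))
    | tail u =>
      cases o with
      | write a => exact .inr (.inr (.inr ⟨_, PlainRegStep.fence a u rfl⟩))
      | read => exact absurd rfl (hy.2.2 rfl u)
    | returning u => exact .inl ⟨_, _, PlainRegStep.respond u⟩
    | finished => exact absurd rfl hy.1
  · intro o p y z v y' h v'
    cases h with
    | read _ h => exact ⟨_, PlainRegStep.read v' h⟩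

theorem fencedReg_fenceAround (A : Set Val) (x : Var) : FenceAround (fencedReg P A x) := by
  have H : ∀ p o, FenceShape (fencedReg P A x o p) 1 1 := by
    intro p o
    refine fenceShape_of_phase _ 1 1 le_rfl (fun s : RegState Val => match s with
      | .begin => .before
      | .body => .body
      | .tail _ => .body
      | .returning _ => .after
      | .finished => .after) rfl ?_ ?_
    · intro y e y' h
      cases h <;> simp [MemAct.IsRW]
    · intro y e y' h
      cases h; simp
  exact fun p => ⟨fun a => H p _, H p _⟩

theorem plainReg_fenceAfterWrite (A : Set Val) (x : Var) : FenceAfterWrite (plainReg P A x) := by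
  refine fun p => ⟨fun a => ?_, ?_⟩
  · refine fenceShape_of_phase _ 0 1 zero_le_one (fun s : RegState Val => match s with
      | .begin => .body
      | .body => .body
      | .tail _ => .body
      | .returning _ => .after
      | .finished => .after) rfl ?_ ?_
    · intro y e y' h
      cases h <;> simp_all [MemAct.IsRW]
    · intro y e y' h
      cases h; simp
  · refine fenceShape_of_phase _ 0 0 zero_le_one (fun _ => .body) rfl ?_ ?_
    · intro y e y' h
      cases h <;> simp_all [MemAct.IsRW]
    · intro y e y' h
      cases h; simp

/-! ### The register under release/acquire. -/

/-- The transition function of registers. -/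
def regNext [Zero Val] {A : Set Val} (s : Val) (o : RegOp A) : Val :=
  match o with
  | .write a => (a : Val)
  | .read => s

/-- The state of a process of the fenced register with view `V` of the shared variable, where the
fence view is `F`. -/
def FencedRegRel {A : Set Val} (V F : ℕ) :
    Option (Σ _ : RegOp A, RegState Val) → Status ℕ (RegOp A) (RegRet Val) → Prop
  | none, st => st = .idle
  -- The opening fence turns a bound by the fence view into one by the own view; the closing fence
  -- turns it back, now for the key.
  | some ⟨o, .begin⟩, st => ∃ f, st = .pending o f ∧ f ≤ F
  | some ⟨o, .body⟩, st => ∃ f, st = .pending o f ∧ f ≤ V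
  | some ⟨_, .tail u⟩, st => ∃ k, st = .committed u k ∧ k ≤ V
  | some ⟨_, .returning u⟩, st => ∃ k, st = .committed u k ∧ k ≤ F
  | some ⟨_, .finished⟩, _ => False

theorem FencedRegRel.mono {A : Set Val} {V F V' F' : ℕ} {q : Option (Σ _ : RegOp A, RegState Val)}
    {st : Status ℕ (RegOp A) (RegRet Val)} (h : FencedRegRel V F q st) (hV : V ≤ V')
    (hF : F ≤ F') : FencedRegRel V' F' q st := by
  rcases q with _ | ⟨o, _ | _ | u | u | _⟩
  · exact h
  · exact let ⟨f, h1, h2⟩ := h; ⟨f, h1, h2.trans hF⟩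
  · exact let ⟨f, h1, h2⟩ := h; ⟨f, h1, h2.trans hV⟩
  · exact let ⟨f, h1, h2⟩ := h; ⟨f, h1, h2.trans hV⟩
  · exact let ⟨f, h1, h2⟩ := h; ⟨f, h1, h2.trans hF⟩
  · exact h

/-- The simulation relation of the fenced register: keys are timestamps. -/
structure FencedRegSim {A : Set Val} (x : Var) (q : P → Option (Σ _ : RegOp A, RegState Val))
    (s : RAState P Var Val) (a : KState P ℕ (RegOp A) (RegRet Val) Val) : Prop where
  keys : ∀ t, t ∈ a.keys ↔ ∃ μ ∈ s.mem, μ.var = x ∧ μ.time = t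
  val : ∀ μ ∈ s.mem, μ.var = x → a.val μ.time = μ.val
  done : a.done ≤ s.fview x
  proc : ∀ p, FencedRegRel (s.view p x) (s.fview x) (q p) (a.status p)

/-- A write picks an unused timestamp above its view, hence above its floor; a read observes at the
timestamp of its view. A register write ignores the previous state, so `ok` can be trivial. -/
theorem fencedReg_linearizable [Finite P] [DecidableEq P] [DecidableEq Var] [Zero Val] (A : Set Val)
    (x : Var) : Linearizable (Reg P A) (fencedReg P A x) (RA P Var Val) := by
  refine linearizable_of_simulation (next := regNext) (out := regOut) (s₀ := (0 : Val))
    (fun _ _ => True) (0 : ℕ) trivial (FencedRegSim x) ?_ ?_ ?_ ?_ ?_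
  · constructor
    · intro t
      constructor
      · rintro rfl
        exact ⟨_, ⟨x, rfl⟩, rfl, rfl⟩
      · rintro ⟨μ, ⟨y, rfl⟩, _, rfl⟩
        rfl
    · rintro μ ⟨y, rfl⟩ _
      rfl
    · exact le_rfl
    · intro p
      rfl
  · rintro q s s' h a hr ⟨hk, hv, hd, hp⟩ hs
    refine ⟨a, hr, ?_⟩
    cases hs with
    | propagate m V Vf p μ hμ _ =>
      refine ⟨hk, hv, hd, fun p' => (hp p').mono ?_ le_rfl⟩
      by_cases hpp : p' = p
      · subst hpp; simp
      · simp [hpp]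
  · rintro q s h a p o hr ⟨hk, hv, hd, hp⟩ hq
    have h1 := hp p
    rw [hq] at h1
    refine ⟨_, hr.inv p o h1, hk, hv, hd, fun p' => ?_⟩
    by_cases hpp : p' = p
    · subst hpp
      simp only [Function.update_self]
      exact ⟨_, rfl, hd⟩
    · simpa [hpp] using hp p'
  · rintro q s s' h a p o y y' e hr ⟨hk, hv, hd, hp⟩ hq hy hs
    have h1 := hp p
    rw [hq] at h1
    cases hy with
    | fence₁ =>
      cases hs with
      | fence m V Vf p =>
        obtain ⟨f, h1, h2⟩ := h1
        refine ⟨a, hr, hk, hv, hd.trans le_sup_right, fun p' => ?_⟩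
        by_cases hpp : p' = p
        · subst hpp
          simp only [Function.update_self]
          exact ⟨_, h1, h2.trans le_sup_right⟩
        · simpa [hpp] using (hp p').mono le_rfl le_sup_right
    | fence₂ u =>
      cases hs with
      | fence m V Vf p =>
        obtain ⟨f, h1, h2⟩ := h1
        refine ⟨a, hr, hk, hv, hd.trans le_sup_right, fun p' => ?_⟩
        by_cases hpp : p' = p
        · subst hpp
          simp only [Function.update_self]
          exact ⟨_, h1, h2.trans le_sup_left⟩
        · simpa [hpp] using (hp p').mono le_rfl le_sup_right
    | write b ho =>
      subst ho
      cases hs with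
      | write m V Vf p x v t ht hfresh =>
        obtain ⟨f, h1, h2⟩ := h1
        have hnk : t ∉ a.keys := fun h => by
          obtain ⟨μ, hμ, h3, h4⟩ := (hk t).1 h
          exact hfresh μ hμ h3 h4
        refine ⟨_, hr.effect p _ f t (b : Val) .ack h1 (lt_of_le_of_lt h2 ht) (Nat.zero_le _) trivial
          (fun h => absurd h hnk) (fun _ _ _ _ => ⟨rfl, rfl⟩), ?_, ?_, hd, fun p' => ?_⟩
        · intro k
          simp only [Set.mem_insert_iff, hk, Set.mem_union, Set.mem_singleton_iff]
          constructor
          · rintro (rfl | ⟨μ, h3, h4⟩)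
            · exact ⟨_, .inr rfl, rfl, rfl⟩
            · exact ⟨μ, .inl h3, h4⟩
          · rintro ⟨μ, h3 | rfl, h4⟩
            · exact .inr ⟨μ, h3, h4⟩
            · exact .inl h4.2.symm
        · rintro μ (hμ | rfl) hx
          · have : μ.time ≠ t := hfresh μ hμ hx
            simpa [this] using hv μ hμ hx
          · simp
        · by_cases hpp : p' = p
          · subst hpp
            simp only [Function.update_self]
            exact ⟨_, rfl, le_rfl⟩
          · simpa [hpp] using hp p'
    | read v ho =>
      subst ho
      cases hs with
      | read m V Vf p x v U hμ =>
        obtain ⟨f, h1, h2⟩ := h1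
        refine ⟨_, hr.observe p _ f (V p x) h1 h2 ((hk _).2 ⟨_, hμ, rfl, rfl⟩) rfl,
          hk, hv, hd, fun p' => ?_⟩
        by_cases hpp : p' = p
        · subst hpp
          simp only [Function.update_self]
          have := hv _ hμ rfl
          simp only at this
          exact ⟨_, by rw [this]; rfl, le_rfl⟩
        · simpa [hpp] using hp p'
  · rintro q s h a p o y y' u hr ⟨hk, hv, hd, hp⟩ hq hy
    have h1 := hp p
    rw [hq] at h1
    cases hy with
    | respond u =>
      obtain ⟨k, h1, h2⟩ := h1
      refine ⟨_, hr.res p u k h1, hk, hv, max_le hd h2, fun p' => ?_⟩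
      by_cases hpp : p' = p
      · subst hpp
        simp only [Function.update_self]
        rfl
      · simpa [hpp] using hp p'

/-! ### The register under total store order. -/

/-- The state of a process of the plain register with store buffer `b`, when `T` writes have
reached the main memory. -/
def PlainRegRel {A : Set Val} (x : Var) (T : ℕ) (b : List (Var × Val)) :
    Option (Σ _ : RegOp A, RegState Val) → Status ℕ (RegOp A) (RegRet Val) → Prop
  | none, st => st = .idle ∧ b = []
  | some ⟨o, .body⟩, st => (∃ f, st = .pending o f ∧ f ≤ T) ∧ b = []
  | some ⟨_, .tail u⟩, st => (∃ (a : A) (f : ℕ), st = .pending (.write a) f ∧ f ≤ T ∧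
      b = [(x, (a : Val))] ∧ u = .ack) ∨ (∃ k, st = .committed u k ∧ k ≤ T ∧ b = [])
  | some ⟨_, .returning u⟩, st => (∃ k, st = .committed u k ∧ k ≤ T) ∧ b = []
  | some ⟨_, _⟩, _ => False

theorem PlainRegRel.mono {A : Set Val} {x : Var} {T T' : ℕ} {b : List (Var × Val)}
    {q : Option (Σ _ : RegOp A, RegState Val)} {st : Status ℕ (RegOp A) (RegRet Val)}
    (h : PlainRegRel x T b q st) (hT : T ≤ T') : PlainRegRel x T' b q st := by
  rcases q with _ | ⟨o, _ | _ | u | u | _⟩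
  · exact h
  · exact h
  · obtain ⟨⟨f, h1, h2⟩, h3⟩ := h
    exact ⟨⟨f, h1, h2.trans hT⟩, h3⟩
  · rcases h with ⟨a, f, h1, h2, h3⟩ | ⟨k, h1, h2, h3⟩
    · exact .inl ⟨a, f, h1, h2.trans hT, h3⟩
    · exact .inr ⟨k, h1, h2.trans hT, h3⟩
  · obtain ⟨⟨f, h1, h2⟩, h3⟩ := h
    exact ⟨⟨f, h1, h2.trans hT⟩, h3⟩
  · exact h

/-- The simulation relation of the plain register: keys count the writes that have reached the main
memory. -/
def PlainRegSim {A : Set Val} (x : Var) (q : P → Option (Σ _ : RegOp A, RegState Val))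
    (s : (Var → Val) × (P → List (Var × Val))) (a : KState P ℕ (RegOp A) (RegRet Val) Val) : Prop :=
  ∃ T, T ∈ a.keys ∧ (∀ k ∈ a.keys, k ≤ T) ∧ a.val T = s.1 x ∧ a.done ≤ T ∧
    ∀ p, PlainRegRel x T (s.2 p) (q p) (a.status p)

/-- Thanks to the fence after each write, a buffer holds at most the one write being executed and is
empty in every other phase. So reads see the main memory, whose current content belongs to the
largest key. -/
theorem plainReg_linearizable [Finite P] [DecidableEq P] [DecidableEq Var] [Zero Val] (A : Set Val)
    (x : Var) : Linearizable (Reg P A) (plainReg P A x) (TSO P Var Val) := by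
  refine linearizable_of_simulation (next := regNext) (out := regOut) (s₀ := (0 : Val))
    (fun _ _ => True) (0 : ℕ) trivial (PlainRegSim x) ?_ ?_ ?_ ?_ ?_
  · exact ⟨0, rfl, fun k hk => le_of_eq hk, rfl, le_rfl, fun p => ⟨rfl, rfl⟩⟩
  · rintro q s s' h a hr ⟨T, hT, hk, hv, hd, hp⟩ hs
    cases hs with
    | propagate m b p y v β hb =>
      have h1 := hp p
      simp only [hb] at h1
      generalize hqp : q p = qp at h1
      rcases qp with _ | ⟨o, _ | _ | u | u | _⟩
      · exact absurd h1.2 (by simp)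
      · exact absurd h1 (by simp [PlainRegRel])
      · exact absurd h1.2 (by simp)
      · rcases h1 with ⟨c, f, h1, h2, h3, rfl⟩ | ⟨k, _, _, h3⟩
        · simp only [List.cons.injEq, Prod.mk.injEq] at h3
          obtain ⟨⟨rfl, rfl⟩, rfl⟩ := h3
          -- The write commits here, in a silent step, at a key above all others.
          refine ⟨_, hr.effect p _ f (T + 1) (c : Val) .ack h1 (by omega) (Nat.zero_le _) trivial
            (fun h => absurd (hk _ h) (by omega)) (fun _ _ _ _ => ⟨rfl, rfl⟩),
            T + 1, by simp, ?_, by simp, by simp only; omega, fun p' => ?_⟩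
          · rintro k (rfl | h)
            · exact le_rfl
            · exact (hk k h).trans (Nat.le_succ _)
          · by_cases hpp : p' = p
            · subst hpp
              simp only [Function.update_self, hqp]
              exact .inr ⟨_, rfl, le_rfl, rfl⟩
            · simpa [hpp] using (hp p').mono (Nat.le_succ _)
        · exact absurd h3 (by simp)
      · exact absurd h1.2 (by simp)
      · exact absurd h1 (by simp [PlainRegRel])
  · rintro q s h a p o hr ⟨T, hT, hk, hv, hd, hp⟩ hq
    have h1 := hp p
    rw [hq] at h1
    refine ⟨_, hr.inv p o h1.1, T, hT, hk, hv, hd, fun p' => ?_⟩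
    by_cases hpp : p' = p
    · subst hpp
      simp only [Function.update_self]
      exact ⟨⟨_, rfl, hd⟩, h1.2⟩
    · simpa [hpp] using hp p'
  · rintro q s s' h a p o y y' e hr ⟨T, hT, hk, hv, hd, hp⟩ hq hy hs
    have h1 := hp p
    rw [hq] at h1
    cases hy with
    | write c ho =>
      subst ho
      cases hs with
      | write m b p x v =>
        obtain ⟨⟨f, h1, h2⟩, h3⟩ := h1
        simp only at h3
        refine ⟨a, hr, T, hT, hk, hv, hd, fun p' => ?_⟩
        by_cases hpp : p' = p
        · subst hpp
          simp only [Function.update_self, h3]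
          exact .inl ⟨c, f, h1, h2, rfl, rfl⟩
        · simpa [hpp] using hp p'
    | read v ho =>
      subst ho
      obtain ⟨⟨f, h1, h2⟩, h3⟩ := h1
      have hs' : s' = s ∧ s.1 x = v := by
        cases hs with
        | readBuffer m b p x v β hβ =>
          simp only at h3
          simp [h3] at hβ
        | readMemory m b p x v _ hm => exact ⟨rfl, hm⟩
      obtain ⟨rfl, rfl⟩ := hs'
      refine ⟨_, hr.observe p _ f T h1 h2 hT rfl, T, hT, hk, hv, hd, fun p' => ?_⟩
      by_cases hpp : p' = p
      · subst hpp
        simp only [Function.update_self, hv]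
        exact ⟨⟨_, rfl, le_rfl⟩, h3⟩
      · simpa [hpp] using hp p'
    | fence _ u ho =>
      cases hs with
      | fence m b p hb =>
        refine ⟨a, hr, T, hT, hk, hv, hd, fun p' => ?_⟩
        by_cases hpp : p' = p
        · subst hpp
          simp only [Function.update_self]
          -- The fence needs an empty buffer, so the write has been propagated and is committed.
          rcases h1 with ⟨c, f, h1, h2, h3, _⟩ | ⟨k, h1, h2, h3⟩
          · simp [hb] at h3
          · exact ⟨⟨k, h1, h2⟩, h3⟩
        · simpa [hpp] using hp p'
  · rintro q s h a p o y y' u hr ⟨T, hT, hk, hv, hd, hp⟩ hq hy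
    have h1 := hp p
    rw [hq] at h1
    cases hy with
    | respond u =>
      obtain ⟨⟨k, h1, h2⟩, h3⟩ := h1
      refine ⟨_, hr.res p u k h1, T, hT, hk, hv, max_le hd h2, fun p' => ?_⟩
      by_cases hpp : p' = p
      · subst hpp
        simp only [Function.update_self]
        exact ⟨rfl, h3⟩
      · simpa [hpp] using hp p'

end WMM

namespace WMM

variable {N : ℕ} {Var Val : Type}

/-! ### Max-registers -/

theorem le_arrayMax (p : Fin N) (m : Fin N → ℤ) (i : Fin N) : m i ≤ arrayMax p m :=
  Finset.le_sup' m (Finset.mem_univ i)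

theorem exists_arrayMax_eq (p : Fin N) (m : Fin N → ℤ) : ∃ i, arrayMax p m = m i := by
  obtain ⟨i, _, h⟩ := Finset.exists_mem_eq_sup' ⟨p, Finset.mem_univ p⟩ m
  exact ⟨i, h⟩

/-- Transitions of the collect-based max-register without fences except for the one at the end of
`write`. -/
inductive PlainCollectStep (M : Fin N ↪ Var) (ι : ℤ ↪ Val) (o : RegOp ℤ) (p : Fin N) :
    CollectState N → Event (Fin N) Var Val (RegOp ℤ) (RegRet ℤ) → CollectState N → Prop
  | collect (S : Finset (Fin N)) (m : Fin N → ℤ) (i : Fin N) (v : Val) :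
      i ∈ S → PlainCollectStep M ι o p (.collecting S m) (.inl (p, .R (M i) v))
        (.collecting (S.erase i) (Function.update m i (Function.invFun ι v)))
  | respondRead (m : Fin N → ℤ) :
      o = .read → PlainCollectStep M ι o p (.collecting ∅ m)
        (.inr (p, .res (.val (arrayMax p m)))) .finished
  | write (m : Fin N → ℤ) (v : ℤ) :
      o = .write v → arrayMax p m < v →
      PlainCollectStep M ι o p (.collecting ∅ m) (.inl (p, .W (M p) (ι v))) .written
  | writeFence (v : ℤ) :
      o = .write v → PlainCollectStep M ι o p .written (.inl (p, .F)) (.returning .ack)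
  | skipFence (m : Fin N → ℤ) (v : ℤ) :
      o = .write v → ¬ arrayMax p m < v →
      PlainCollectStep M ι o p (.collecting ∅ m) (.inl (p, .F)) (.returning .ack)
  | respond (u : RegRet ℤ) :
      PlainCollectStep M ι o p (.returning u) (.inr (p, .res u)) .finished

/-- The collect-based max-register without fences except for the one at the end of `write`. -/
def plainMaxReg (M : Fin N ↪ Var) (ι : ℤ ↪ Val) :
    Impl (Fin N) Var Val (RegOp ℤ) (RegRet ℤ) := fun o p =>
  { State := CollectState N
    start := .collecting Finset.univ fun _ => 0
    Tr := PlainCollectStep M ι o p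
    tr_proc := by
      intro q e q' h
      cases h <;> rfl
    tr_res := by
      intro q u q' h e q'' h'
      cases h <;> cases h' }

/-! ### Wait-freedom and fence placement of the max-registers. -/

/-- A bound for the number of remaining steps. -/
def collectRank : CollectState N → ℕ
  | .begin => N + 4
  -- After the remaining reads come at most a write, a fence and the response.
  | .collecting S _ => S.card + 3
  | .written => 2
  | .returning _ => 1
  | .finished => 0

theorem collectMaxReg_waitFree (M : Fin N ↪ Var) (ι : ℤ ↪ Val) {Mem : MemModel (Fin N) Var Val}
    (hM : Responsive Mem) : WaitFree (collectMaxReg M ι) Mem := by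
  refine waitFree_of_rank hM (fun _ _ => collectRank) ?_ (fun _ _ s => s ≠ .finished) ?_ ?_ ?_ ?_
  · intro o p y e y' h
    cases h with
    | collect S m i v hi =>
      have := Finset.card_erase_lt_of_mem hi
      simp only [collectRank]
      omega
    | _ => simp [collectRank]
  · rintro o p ⟨⟩
  · intro o p y e y' _ h
    cases h <;> exact nofun
  · intro o p y hy
    cases y with
    | begin => exact .inr (.inr (.inr ⟨_, CollectStep.fence₁⟩))
    | collecting S m =>
      rcases S.eq_empty_or_nonempty with rfl | ⟨i, hi⟩
      · cases o with
        | write v =>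
          by_cases hv : arrayMax p m < v
          · exact .inr (.inl ⟨_, _, _, CollectStep.write m v rfl hv⟩)
          · exact .inr (.inr (.inr ⟨_, CollectStep.skipFence m v rfl hv⟩))
        | read => exact .inr (.inr (.inr ⟨_, CollectStep.readFence m rfl⟩))
      -- Any value serves here, since reads accept every value.
      · exact .inr (.inr (.inl ⟨_, _, _, CollectStep.collect S m i (ι 0) hi⟩))
    | written => exact .inr (.inr (.inr ⟨_, CollectStep.writeFence⟩))
    | returning u => exact .inl ⟨_, _, CollectStep.respond u⟩
    | finished => exact absurd rfl hy
  · intro o p y z v y' h v'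
    cases h with
    | collect S m i _ hi => exact ⟨_, CollectStep.collect S m i v' hi⟩

theorem plainMaxReg_waitFree (M : Fin N ↪ Var) (ι : ℤ ↪ Val) {Mem : MemModel (Fin N) Var Val}
    (hM : Responsive Mem) : WaitFree (plainMaxReg M ι) Mem := by
  refine waitFree_of_rank hM (fun _ _ => collectRank) ?_
    (fun o _ s => s ≠ .finished ∧ s ≠ .begin ∧ (o = .read → s ≠ .written)) ?_ ?_ ?_ ?_
  · intro o p y e y' h
    cases h with
    | collect S m i v hi =>
      have := Finset.card_erase_lt_of_mem hi
      simp only [collectRank]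
      omega
    | _ => simp [collectRank]
  · intro o p
    exact ⟨nofun, nofun, nofun⟩
  · intro o p y e y' _ h
    cases h with
    | write m v ho => exact ⟨nofun, nofun, by simp [ho]⟩
    | _ => exact ⟨nofun, nofun, nofun⟩
  · intro o p y hy
    cases y with
    | begin => exact absurd rfl hy.2.1
    | collecting S m =>
      rcases S.eq_empty_or_nonempty with rfl | ⟨i, hi⟩
      · cases o with
        | write v =>
          by_cases hv : arrayMax p m < v
          · exact .inr (.inl ⟨_, _, _, PlainCollectStep.write m v rfl hv⟩)
          · exact .inr (.inr (.inr ⟨_, PlainCollectStep.skipFence m v rfl hv⟩))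
        | read => exact .inl ⟨_, _, PlainCollectStep.respondRead m rfl⟩
      · exact .inr (.inr (.inl ⟨_, _, _, PlainCollectStep.collect S m i (ι 0) hi⟩))
    | written =>
      cases o with
      | write v => exact .inr (.inr (.inr ⟨_, PlainCollectStep.writeFence v rfl⟩))
      | read => exact absurd rfl (hy.2.2 rfl)
    | returning u => exact .inl ⟨_, _, PlainCollectStep.respond u⟩
    | finished => exact absurd rfl hy.1
  · intro o p y z v y' h v'
    cases h with
    | collect S m i _ hi => exact ⟨_, PlainCollectStep.collect S m i v' hi⟩

/-- The phases of the collect-based max-register. -/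
def collectPhase : CollectState N → Phase
  | .begin => .before
  | .collecting _ _ => .body
  | .written => .body
  | .returning _ => .after
  | .finished => .after

theorem collectMaxReg_fenceAround (M : Fin N ↪ Var) (ι : ℤ ↪ Val) :
    FenceAround (collectMaxReg M ι) := by
  have H : ∀ p o, FenceShape (collectMaxReg M ι o p) 1 1 := by
    intro p o
    refine fenceShape_of_phase _ 1 1 le_rfl collectPhase rfl ?_ ?_
    · intro y e y' h
      cases h <;> simp [MemAct.IsRW, collectPhase]
    · intro y e y' h
      cases h; simp [collectPhase]
  exact fun p => ⟨fun a => H p _, H p _⟩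

theorem plainMaxReg_fenceAfterWrite (M : Fin N ↪ Var) (ι : ℤ ↪ Val) :
    FenceAfterWrite (plainMaxReg M ι) := by
  refine fun p => ⟨fun a => ?_, ?_⟩
  · refine fenceShape_of_phase _ 0 1 zero_le_one collectPhase rfl ?_ ?_
    · intro y e y' h
      cases h <;> simp_all [MemAct.IsRW, collectPhase]
    · intro y e y' h
      cases h <;> simp_all [collectPhase]
  · refine fenceShape_of_phase _ 0 0 zero_le_one (fun _ => .body) rfl ?_ ?_
    · intro y e y' h
      cases h <;> simp_all [MemAct.IsRW]
    · intro y e y' h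
      cases h <;> simp

/-! ### The max-register under release/acquire. -/

/-- The transition function of max-registers. -/
def maxNext (s : ℤ) (o : RegOp ℤ) : ℤ :=
  match o with
  | .write a => max s a
  | .read => s

/-- The integer `z` was written to the entry `i` of the array with timestamp `t`. -/
def Stored (M : Fin N ↪ Var) (ι : ℤ ↪ Val) (m : Set (Msg Var Val)) (i : Fin N) (t : ℕ) (z : ℤ) :
    Prop :=
  ∃ U, (⟨M i, ι z, t, U⟩ : Msg Var Val) ∈ m

/-- The view `V` includes a value of at least `k`. -/
def Seen (M : Fin N ↪ Var) (ι : ℤ ↪ Val) (m : Set (Msg Var Val)) (V : Var → ℕ) (k : ℤ) : Prop :=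
  ∃ i t z, Stored M ι m i t z ∧ t ≤ V (M i) ∧ k ≤ z

theorem Stored.mono {M : Fin N ↪ Var} {ι : ℤ ↪ Val} {m m' : Set (Msg Var Val)} {i : Fin N} {t : ℕ}
    {z : ℤ} (h : Stored M ι m i t z) (hm : m ⊆ m') : Stored M ι m' i t z :=
  let ⟨U, hU⟩ := h
  ⟨U, hm hU⟩

theorem Seen.mono {M : Fin N ↪ Var} {ι : ℤ ↪ Val} {m m' : Set (Msg Var Val)} {V V' : Var → ℕ}
    {k : ℤ} (h : Seen M ι m V k) (hm : m ⊆ m') (hV : V ≤ V') : Seen M ι m' V' k :=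
  let ⟨i, t, z, h1, h2, h3⟩ := h
  ⟨i, t, z, h1.mono hm, h2.trans (hV _), h3⟩

/-- The state of process `p` of the collect-based max-register under release/acquire. -/
def CollectRel (M : Fin N ↪ Var) (ι : ℤ ↪ Val) (mem : Set (Msg Var Val)) (p : Fin N)
    (V F : Var → ℕ) :
    Option (Σ _ : RegOp ℤ, CollectState N) → Status ℤ (RegOp ℤ) (RegRet ℤ) → Prop
  | none, st => st = .idle
  | some ⟨o, .begin⟩, st => ∃ f, st = .pending o f ∧ Seen M ι mem F f
  -- The first clause will put the collected maximum above the floor. The second makes that maximum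
  -- a key which the closing fence publishes. The third says that the own entry was read at its
  -- latest value, so that a write increases it.
  | some ⟨o, .collecting S m⟩, st => ∃ f, st = .pending o f ∧
      (∃ i t z, Stored M ι mem i t z ∧ t ≤ V (M i) ∧ f ≤ z ∧ (i ∉ S → f ≤ m i)) ∧
      (∀ i, i ∉ S → ∃ t, Stored M ι mem i t (m i) ∧ t ≤ V (M i)) ∧
      (p ∉ S → Stored M ι mem p (V (M p)) (m p))
  | some ⟨_, .written⟩, st => ∃ k, st = .committed .ack k ∧ Seen M ι mem V k
  | some ⟨_, .returning u⟩, st => ∃ k, st = .committed u k ∧ Seen M ι mem F k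
  | some ⟨_, .finished⟩, _ => False

/-- The view of the own entry must stay fixed because a collect remembers the value at exactly that
timestamp. Only its owner writes the entry, so joins with other views do not move it. -/
theorem CollectRel.mono {M : Fin N ↪ Var} {ι : ℤ ↪ Val} {mem mem' : Set (Msg Var Val)} {p : Fin N}
    {V V' F F' : Var → ℕ} {q : Option (Σ _ : RegOp ℤ, CollectState N)}
    {st : Status ℤ (RegOp ℤ) (RegRet ℤ)} (h : CollectRel M ι mem p V F q st) (hm : mem ⊆ mem')
    (hV : V ≤ V') (hp : V' (M p) = V (M p)) (hF : F ≤ F') : CollectRel M ι mem' p V' F' q st := by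
  rcases q with _ | ⟨o, _ | ⟨S, m⟩ | _ | u | _⟩
  · exact h
  · exact let ⟨f, h1, h2⟩ := h; ⟨f, h1, h2.mono hm hF⟩
  · obtain ⟨f, h1, ⟨i, t, z, h2, h3, h4⟩, h5, h6⟩ := h
    refine ⟨f, h1, ⟨i, t, z, h2.mono hm, h3.trans (hV _), h4⟩, fun j hj => ?_, fun hj => ?_⟩
    · obtain ⟨t, h7, h8⟩ := h5 j hj
      exact ⟨t, h7.mono hm, h8.trans (hV _)⟩
    · rw [hp]
      exact (h6 hj).mono hm
  · exact let ⟨f, h1, h2⟩ := h; ⟨f, h1, h2.mono hm hV⟩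
  · exact let ⟨f, h1, h2⟩ := h; ⟨f, h1, h2.mono hm hF⟩
  · exact h

/-- The simulation relation of the collect-based max-register under release/acquire: keys are
values. -/
structure CollectSim (M : Fin N ↪ Var) (ι : ℤ ↪ Val)
    (q : Fin N → Option (Σ _ : RegOp ℤ, CollectState N)) (s : RAState (Fin N) Var Val)
    (a : KState (Fin N) ℤ (RegOp ℤ) (RegRet ℤ) ℤ) : Prop where
  wf : s.WellFormed
  nonneg : ∀ k ∈ a.keys, 0 ≤ k
  val : ∀ k ∈ a.keys, a.val k = k
  stored : ∀ μ ∈ s.mem, ∀ i, μ.var = M i → ∃ z ∈ a.keys, μ.val = ι z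
  mono : ∀ i t t' z z', Stored M ι s.mem i t z → Stored M ι s.mem i t' z' → t ≤ t' → z ≤ z'
  own : ∀ p, ∀ μ ∈ s.mem, μ.var = M p → μ.time ≤ s.view p (M p)
  -- `Seen` requires an array entry, which does not exist for `N = 0`.
  done : ∀ _ : Fin N, Seen M ι s.mem s.fview a.done
  proc : ∀ p, CollectRel M ι s.mem p (s.view p) s.fview (q p) (a.status p)

theorem CollectSim.mem_keys {M : Fin N ↪ Var} {ι : ℤ ↪ Val}
    {q : Fin N → Option (Σ _ : RegOp ℤ, CollectState N)} {s : RAState (Fin N) Var Val}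
    {a : KState (Fin N) ℤ (RegOp ℤ) (RegRet ℤ) ℤ} (H : CollectSim M ι q s a) {i : Fin N} {t : ℕ}
    {z : ℤ} (h : Stored M ι s.mem i t z) : z ∈ a.keys := by
  obtain ⟨U, hU⟩ := h
  obtain ⟨z', h1, h2⟩ := H.stored _ hU i rfl
  rwa [ι.injective h2]

variable [DecidableEq Var]

/-- The simulation relation is preserved by a fence of `p` if it holds for `p` afterwards. -/
theorem CollectSim.fence {M : Fin N ↪ Var} {ι : ℤ ↪ Val}
    {q : Fin N → Option (Σ _ : RegOp ℤ, CollectState N)} {m : Set (Msg Var Val)}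
    {V : Fin N → Var → ℕ} {F : Var → ℕ} {a : KState (Fin N) ℤ (RegOp ℤ) (RegRet ℤ) ℤ}
    (H : CollectSim M ι q ⟨m, V, F⟩ a) (p : Fin N) (y : Option (Σ _ : RegOp ℤ, CollectState N))
    (st : Status ℤ (RegOp ℤ) (RegRet ℤ))
    (h : CollectRel M ι m p (V p ⊔ F) (V p ⊔ F) y st) :
    CollectSim M ι (Function.update q p y) ⟨m, Function.update V p (V p ⊔ F), V p ⊔ F⟩
      { a with status := Function.update a.status p st } where
  wf := H.wf.step (RAStep.fence m V F p)
  nonneg := H.nonneg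
  val := H.val
  stored := H.stored
  mono := H.mono
  own p' μ hμ hx := by
    by_cases hpp : p' = p
    · subst hpp
      simpa using Or.inl (H.own p' μ hμ hx)
    · simpa [hpp] using H.own p' μ hμ hx
  done i := (H.done i).mono subset_rfl le_sup_right
  proc p' := by
    by_cases hpp : p' = p
    · subst hpp
      simpa using h
    · simpa [hpp] using (H.proc p').mono subset_rfl le_rfl rfl le_sup_right

variable [Zero Val]

/-- With the state at key `k` equal to `k`, only three facts about the memory matter: values in the
array are keys, entries grow with their timestamps, and owners are up to date on their own entries.
-/
theorem collectMaxReg_linearizable (M : Fin N ↪ Var) (ι : ℤ ↪ Val) (hι : ι 0 = 0) :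
    Linearizable (MaxReg (Fin N)) (collectMaxReg M ι) (RA (Fin N) Var Val) := by
  refine linearizable_of_simulation (next := maxNext) (out := regOut) (s₀ := (0 : ℤ))
    (fun k s => s = k) (0 : ℤ) rfl (CollectSim M ι) ?_ ?_ ?_ ?_ ?_
  · refine ⟨RA_start_wellFormed, ?_, ?_, ?_, ?_, ?_, ?_, fun p => rfl⟩
    · rintro k rfl; exact le_rfl
    · rintro k rfl; rfl
    · rintro μ ⟨x, rfl⟩ i _
      exact ⟨0, rfl, hι.symm⟩
    · rintro i t t' z z' ⟨U, x, hU⟩ ⟨U', x', hU'⟩ _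
      simp only [Msg.mk.injEq] at hU hU'
      rw [ι.injective ((hU.2.1.trans hU'.2.1.symm))]
    · rintro p μ ⟨x, rfl⟩ _
      exact le_rfl
    · exact fun i => ⟨i, 0, 0, ⟨_, M i, by rw [hι]⟩, le_rfl, le_rfl⟩
  · rintro q s s' h a hr H hs
    refine ⟨a, hr, ?_⟩
    have hwf := H.wf.step hs
    cases hs with
    | propagate m V Vf p μ hμ _ =>
      refine ⟨hwf, H.nonneg, H.val, H.stored, H.mono, fun p' ν hν hx => ?_, H.done, fun p' => ?_⟩
      · by_cases hpp : p' = p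
        · subst hpp
          simpa using Or.inl (H.own p' ν hν hx)
        · simpa [hpp] using H.own p' ν hν hx
      · by_cases hpp : p' = p
        · subst hpp
          simp only [Function.update_self]
          refine (H.proc p').mono subset_rfl le_sup_left ?_ le_rfl
          -- The view of a message is populated, so at `M p'` it is the timestamp of a message of
          -- that entry, and none of these is ahead of the owner.
          obtain ⟨ν, hν, h1, h2⟩ := H.wf.msg μ hμ (M p')
          have := H.own p' ν hν h1
          rw [Pi.sup_apply, ← h2]
          exact sup_eq_left.2 this
        · simpa [hpp] using H.proc p'
  · rintro q s h a p o hr H hq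
    have h1 := H.proc p
    rw [hq] at h1
    refine ⟨_, hr.inv p o h1, H.wf, H.nonneg, H.val, H.stored, H.mono, H.own, H.done,
      fun p' => ?_⟩
    by_cases hpp : p' = p
    · subst hpp
      simp only [Function.update_self]
      exact ⟨_, rfl, H.done p'⟩
    · simpa [hpp] using H.proc p'
  · rintro q s s' h a p o y y' e hr H hq hy hs
    have h1 := H.proc p
    rw [hq] at h1
    have hwf := H.wf.step hs
    cases hy with
    | fence₁ =>
      cases hs with
      | fence m V Vf p =>
        obtain ⟨f, h1, i, t, z, h2, h3, h4⟩ := h1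
        refine ⟨a, hr, ?_⟩
        have := H.fence p (some ⟨o, .collecting Finset.univ fun _ => 0⟩) (a.status p)
          ⟨f, h1, ⟨i, t, z, h2, h3.trans (le_sup_right (a := V p) (b := Vf) _), h4, by simp⟩,
            by simp, by simp⟩
        rw [Function.update_eq_self] at this
        exact this
    | writeFence =>
      cases hs with
      | fence m V Vf p =>
        obtain ⟨k, h1, h2⟩ := h1
        refine ⟨a, hr, ?_⟩
        have := H.fence p (some ⟨o, .returning .ack⟩) (a.status p)
          ⟨k, h1, h2.mono subset_rfl le_sup_left⟩
        rw [Function.update_eq_self] at this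
        exact this
    | collect S c i v hi =>
      cases hs with
      | read m V Vf p _ _ U hμ =>
        obtain ⟨f, h1, ⟨j, t, z, h2, h3, h4, h5⟩, h6, h7⟩ := h1
        obtain ⟨w, hw, hvw⟩ := H.stored _ hμ i rfl
        simp only at hvw
        subst hvw
        have hinv : Function.invFun ι (ι w) = w := Function.leftInverse_invFun ι.injective w
        have hst : Stored M ι m i (V p (M i)) w := ⟨U, hμ⟩
        refine ⟨a, hr, hwf, H.nonneg, H.val, H.stored, H.mono, H.own, H.done, fun p' => ?_⟩
        by_cases hpp : p' = p
        · subst hpp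
          simp only [Function.update_self, hinv]
          refine ⟨f, h1, ⟨j, t, z, h2, h3, h4, fun hj => ?_⟩, fun k hk => ?_, fun hk => ?_⟩
          · by_cases hji : j = i
            · subst hji
              -- The value read is at least as recent as the one known to reach the floor, hence at
              -- least as large.
              simpa using h4.trans (H.mono _ _ _ _ _ h2 hst h3)
            · simpa [hji] using h5 (by simpa [hji] using hj)
          · by_cases hki : k = i
            · subst hki
              exact ⟨_, by simpa using hst, le_rfl⟩
            · simpa [hki] using h6 k (by simpa [hki] using hk)
          · by_cases hki : p' = i
            · subst hki
              simpa using hst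
            · simpa [hki] using h7 (by simpa [hki] using hk)
        · simpa [hpp] using H.proc p'
    | readFence c ho =>
      subst ho
      cases hs with
      | fence m V Vf p =>
        obtain ⟨f, h1, ⟨j, t, z, h2, h3, h4, h5⟩, h6, h7⟩ := h1
        obtain ⟨i, hi⟩ := exists_arrayMax_eq p c
        obtain ⟨t', h8, h9⟩ := h6 i (by simp)
        have hk : arrayMax p c ∈ a.keys := hi ▸ H.mem_keys h8
        refine ⟨_, hr.observe p _ f (arrayMax p c) h1 ((h5 (by simp)).trans (le_arrayMax p c j)) hk
          rfl, ?_⟩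
        rw [H.val _ hk]
        exact H.fence p _ _ ⟨_, rfl, i, t', _, h8,
          h9.trans (le_sup_left (a := V p) (b := Vf) _), hi.le⟩
    | skipFence c v ho hv =>
      subst ho
      cases hs with
      | fence m V Vf p =>
        obtain ⟨f, h1, ⟨j, t, z, h2, h3, h4, h5⟩, h6, h7⟩ := h1
        obtain ⟨i, hi⟩ := exists_arrayMax_eq p c
        obtain ⟨t', h8, h9⟩ := h6 i (by simp)
        have hk : arrayMax p c ∈ a.keys := hi ▸ H.mem_keys h8
        -- A write not above the collected maximum leaves the state at that key unchanged, so it is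
        -- an observer.
        refine ⟨_, hr.observe p _ f (arrayMax p c) h1 ((h5 (by simp)).trans (le_arrayMax p c j)) hk
          (by rw [H.val _ hk]; exact max_eq_left (not_lt.1 hv)), ?_⟩
        exact H.fence p _ _ ⟨_, rfl, i, t', _, h8,
          h9.trans (le_sup_left (a := V p) (b := Vf) _), hi.le⟩
    | write c v ho hv =>
      subst ho
      cases hs with
      | write m V Vf p _ _ t ht hfresh =>
        obtain ⟨f, h1, ⟨j, _, z, h2, h3, h4, h5⟩, h6, h7⟩ := h1
        have h7 := h7 (by simp)
        have hcp : c p < v := lt_of_le_of_lt (le_arrayMax p c p) hv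
        have hfv : f < v := lt_of_le_of_lt ((h5 (by simp)).trans (le_arrayMax p c j)) hv
        have hv0 : 0 ≤ v := (H.nonneg _ (H.mem_keys h7)).trans hcp.le
        have hsub : m ⊆ m ∪ {⟨M p, ι v, t, Function.update (V p) (M p) t⟩} :=
          Set.subset_union_left
        have hV : V p ≤ Function.update (V p) (M p) t := by
          intro x
          by_cases hx : x = M p
          · subst hx; simpa using ht.le
          · simp [hx]
        have hStored : ∀ i t' z, Stored M ι
            (m ∪ {⟨M p, ι v, t, Function.update (V p) (M p) t⟩}) i t' z →
            Stored M ι m i t' z ∨ i = p ∧ t' = t ∧ z = v := by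
          rintro i t' z ⟨U, hU | hU⟩
          · exact .inl ⟨U, hU⟩
          · simp only [Set.mem_singleton_iff, Msg.mk.injEq, EmbeddingLike.apply_eq_iff_eq] at hU
            exact .inr ⟨hU.1, hU.2.2.1, hU.2.1⟩
        -- The key `v` may already be in use by another write of `v`; the state there is `v` anyway.
        refine ⟨_, hr.effect p _ f v v .ack h1 hfv hv0 rfl (H.val v) ?_, hwf, ?_, ?_, ?_, ?_, ?_,
          ?_, fun p' => ?_⟩
        · rintro k hk s rfl
          exact ⟨max_eq_right hk, rfl⟩
        · rintro k (rfl | hk)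
          · exact hv0
          · exact H.nonneg k hk
        · rintro k (rfl | hk)
          · simp
          · by_cases hkv : k = v
            · simp [hkv]
            · simpa [hkv] using H.val k hk
        · rintro μ (hμ | rfl) i hi
          · obtain ⟨z, h8, h9⟩ := H.stored μ hμ i hi
            exact ⟨z, .inr h8, h9⟩
          · exact ⟨v, .inl rfl, rfl⟩
        · intro i t₁ t₂ z₁ z₂ hs₁ hs₂ hle
          rcases hStored _ _ _ hs₁ with h8 | ⟨rfl, rfl, rfl⟩ <;>
            rcases hStored _ _ _ hs₂ with h9 | ⟨h9, rfl, rfl⟩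
          · exact H.mono _ _ _ _ _ h8 h9 hle
          · subst h9
            obtain ⟨U, hU⟩ := id h8
            -- Older values of the own entry are at most the latest one, which the process has
            -- collected and which is below `v`. The opposite order of timestamps cannot occur, as
            -- `t` exceeds the own view.
            exact (H.mono _ _ _ _ _ h8 h7 (H.own _ _ hU rfl)).trans hcp.le
          · obtain ⟨U, hU⟩ := h9
            have := H.own _ _ hU rfl
            simp only at this
            omega
          · exact le_rfl
        · rintro p' μ (hμ | rfl) hx
          · have := H.own p' μ hμ hx
            by_cases hpp : p' = p
            · subst hpp
              simpa using this.trans ht.le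
            · simpa [hpp] using this
          · have : p = p' := M.injective hx
            subst this
            simp
        · exact fun i => (H.done i).mono hsub le_rfl
        · by_cases hpp : p' = p
          · subst hpp
            simp only [Function.update_self]
            exact ⟨v, rfl, p', t, v, ⟨_, .inr rfl⟩, by simp, le_rfl⟩
          · simpa [hpp] using (H.proc p').mono hsub le_rfl rfl le_rfl
  · rintro q s h a p o y y' u hr H hq hy
    have h1 := H.proc p
    rw [hq] at h1
    cases hy with
    | respond u =>
      obtain ⟨k, h1, h2⟩ := h1
      refine ⟨_, hr.res p u k h1, H.wf, H.nonneg, H.val, H.stored, H.mono, H.own, fun i => ?_,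
        fun p' => ?_⟩
      · rcases max_choice a.done k with h3 | h3 <;> simp only [h3]
        · exact H.done i
        · exact h2
      · by_cases hpp : p' = p
        · subst hpp
          simp only [Function.update_self]
          rfl
        · simpa [hpp] using H.proc p'

end WMM

/-! ### The max-register under total store order. -/

namespace WMM

variable {N : ℕ} {Var Val : Type}

/-- The main memory includes a value of at least `k`. -/
def Visible (M : Fin N ↪ Var) (ι : ℤ ↪ Val) (m : Var → Val) (k : ℤ) : Prop :=
  ∃ i z, m (M i) = ι z ∧ k ≤ z

/-- The entries of the array grow from `m` to `m'`. -/
def ArrayLE (M : Fin N ↪ Var) (ι : ℤ ↪ Val) (m m' : Var → Val) : Prop :=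
  ∀ i z, m (M i) = ι z → ∃ z', m' (M i) = ι z' ∧ z ≤ z'

theorem Visible.mono {M : Fin N ↪ Var} {ι : ℤ ↪ Val} {m m' : Var → Val} {k : ℤ}
    (h : Visible M ι m k) (hm : ArrayLE M ι m m') : Visible M ι m' k :=
  let ⟨i, z, h1, h2⟩ := h
  let ⟨z', h3, h4⟩ := hm i z h1
  ⟨i, z', h3, h2.trans h4⟩

/-- The state of process `p`, with store buffer `b`, of the collect-based max-register under total
store order. -/
def PlainCollectRel (M : Fin N ↪ Var) (ι : ℤ ↪ Val) (keys : Set ℤ) (m : Var → Val) (p : Fin N)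
    (b : List (Var × Val)) :
    Option (Σ _ : RegOp ℤ, CollectState N) → Status ℤ (RegOp ℤ) (RegRet ℤ) → Prop
  | none, st => st = .idle ∧ b = []
  | some ⟨o, .collecting S c⟩, st => b = [] ∧ ∃ f, st = .pending o f ∧
      (∃ i z, m (M i) = ι z ∧ f ≤ z ∧ (i ∉ S → f ≤ c i)) ∧
      (∀ i, i ∉ S → c i ∈ keys ∧ ∃ z, m (M i) = ι z ∧ c i ≤ z) ∧
      (p ∉ S → m (M p) = ι (c p))
  -- The operation is committed whether or not its store has left the buffer; until then the old
  -- entry is known to be at most `k`.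
  | some ⟨_, .written⟩, st => ∃ k, st = .committed .ack k ∧
      (b = [(M p, ι k)] ∧ k ∈ keys ∧ (∃ z, m (M p) = ι z ∧ z ≤ k) ∨ b = [] ∧ Visible M ι m k)
  | some ⟨_, .returning u⟩, st => b = [] ∧ ∃ k, st = .committed u k ∧ Visible M ι m k
  | some ⟨_, _⟩, _ => False

theorem PlainCollectRel.mono {M : Fin N ↪ Var} {ι : ℤ ↪ Val} {keys keys' : Set ℤ}
    {m m' : Var → Val} {p : Fin N} {b : List (Var × Val)}
    {q : Option (Σ _ : RegOp ℤ, CollectState N)} {st : Status ℤ (RegOp ℤ) (RegRet ℤ)}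
    (h : PlainCollectRel M ι keys m p b q st) (hk : keys ⊆ keys') (hm : ArrayLE M ι m m')
    (hp : m' (M p) = m (M p)) : PlainCollectRel M ι keys' m' p b q st := by
  rcases q with _ | ⟨o, _ | ⟨S, c⟩ | _ | u | _⟩
  · exact h
  · exact h
  · obtain ⟨hb, f, h1, ⟨i, z, h2, h3, h4⟩, h5, h6⟩ := h
    refine ⟨hb, f, h1, ?_, fun j hj => ?_, fun hj => ?_⟩
    · obtain ⟨z', h7, h8⟩ := hm i z h2
      exact ⟨i, z', h7, h3.trans h8, h4⟩
    · obtain ⟨h7, z, h8, h9⟩ := h5 j hj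
      obtain ⟨z', h10, h11⟩ := hm j z h8
      exact ⟨hk h7, z', h10, h9.trans h11⟩
    · rw [hp]
      exact h6 hj
  · obtain ⟨k, h1, ⟨h2, h3, h4⟩ | ⟨h2, h3⟩⟩ := h
    · exact ⟨k, h1, .inl ⟨h2, hk h3, by rwa [hp]⟩⟩
    · exact ⟨k, h1, .inr ⟨h2, h3.mono hm⟩⟩
  · obtain ⟨hb, k, h1, h2⟩ := h
    exact ⟨hb, k, h1, h2.mono hm⟩
  · exact h

/-- The simulation relation of the collect-based max-register under total store order: keys are
values. -/
structure PlainCollectSim (M : Fin N ↪ Var) (ι : ℤ ↪ Val)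
    (q : Fin N → Option (Σ _ : RegOp ℤ, CollectState N))
    (s : (Var → Val) × (Fin N → List (Var × Val)))
    (a : KState (Fin N) ℤ (RegOp ℤ) (RegRet ℤ) ℤ) : Prop where
  nonneg : ∀ k ∈ a.keys, 0 ≤ k
  val : ∀ k ∈ a.keys, a.val k = k
  stored : ∀ i, ∃ z ∈ a.keys, s.1 (M i) = ι z
  done : ∀ _ : Fin N, Visible M ι s.1 a.done
  proc : ∀ p, PlainCollectRel M ι a.keys s.1 p (s.2 p) (q p) (a.status p)

variable [DecidableEq Var] [Zero Val]

/-- Unlike in the register, a write commits when it enters the buffer. Its key does not depend on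
when it is propagated, and the fence makes the value visible before the response raises the floors
of later operations. An opening fence is unnecessary because the main memory already covers every
completed operation. -/
theorem plainMaxReg_linearizable (M : Fin N ↪ Var) (ι : ℤ ↪ Val) (hι : ι 0 = 0) :
    Linearizable (MaxReg (Fin N)) (plainMaxReg M ι) (TSO (Fin N) Var Val) := by
  refine linearizable_of_simulation (next := maxNext) (out := regOut) (s₀ := (0 : ℤ))
    (fun k s => s = k) (0 : ℤ) rfl (PlainCollectSim M ι) ?_ ?_ ?_ ?_ ?_
  · refine ⟨?_, ?_, ?_, ?_, fun p => ⟨rfl, rfl⟩⟩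
    · rintro k rfl; exact le_rfl
    · rintro k rfl; rfl
    · exact fun i => ⟨0, rfl, hι.symm⟩
    · exact fun i => ⟨i, 0, hι.symm, le_rfl⟩
  · rintro q s s' h a hr H hs
    refine ⟨a, hr, ?_⟩
    cases hs with
    | propagate m b p x v β hb =>
      have h1 := H.proc p
      simp only [hb] at h1
      generalize hqp : q p = qp at h1
      rcases qp with _ | ⟨o, _ | ⟨S, c⟩ | _ | u | _⟩
      · exact absurd h1.2 (by simp)
      · exact absurd h1 (by simp [PlainCollectRel])
      · exact absurd h1.1 (by simp)
      · obtain ⟨k, h1, ⟨h2, h3, z, h4, h5⟩ | ⟨h2, _⟩⟩ := h1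
        · simp only [List.cons.injEq, Prod.mk.injEq] at h2
          obtain ⟨⟨rfl, rfl⟩, rfl⟩ := h2
          -- Propagation replaces an entry by a value that is at least as large, so collects in
          -- progress keep their bounds.
          have hle : ArrayLE M ι m (Function.update m (M p) (ι k)) := by
            intro i w hw
            by_cases hip : i = p
            · subst hip
              have : w = z := ι.injective (hw.symm.trans h4)
              exact ⟨k, by simp, this ▸ h5⟩
            · exact ⟨w, by simpa [hip] using hw, le_rfl⟩
          refine ⟨H.nonneg, H.val, fun i => ?_, fun i => (H.done i).mono hle, fun p' => ?_⟩
          · by_cases hip : i = p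
            · subst hip
              exact ⟨k, h3, by simp⟩
            · simpa [hip] using H.stored i
          · by_cases hpp : p' = p
            · subst hpp
              simp only [Function.update_self, hqp]
              exact ⟨k, h1, .inr ⟨rfl, p', k, by simp, le_rfl⟩⟩
            · have := (H.proc p').mono subset_rfl hle (by simp [hpp])
              simpa [hpp] using this
        · exact absurd h2 (by simp)
      · exact absurd h1.1 (by simp)
      · exact absurd h1 (by simp [PlainCollectRel])
  · rintro q s h a p o hr H hq
    have h1 := H.proc p
    rw [hq] at h1
    refine ⟨_, hr.inv p o h1.1, H.nonneg, H.val, H.stored, H.done, fun p' => ?_⟩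
    by_cases hpp : p' = p
    · subst hpp
      simp only [Function.update_self]
      obtain ⟨i, z, h2, h3⟩ := H.done p'
      exact ⟨h1.2, _, rfl, ⟨i, z, h2, h3, by simp⟩, by simp, by simp⟩
    · simpa [hpp] using H.proc p'
  · rintro q s s' h a p o y y' e hr H hq hy hs
    have h1 := H.proc p
    rw [hq] at h1
    cases hy with
    | collect S c i v hi =>
      obtain ⟨hb, f, h1, ⟨j, z, h2, h3, h4⟩, h5, h6⟩ := h1
      -- The buffer is empty during a collect, so the value comes from the main memory.
      have hs' : s' = s ∧ s.1 (M i) = v := by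
        cases hs with
        | readBuffer m b p x v β hβ =>
          simp only at hb
          simp [hb] at hβ
        | readMemory m b p x v _ hm => exact ⟨rfl, hm⟩
      obtain ⟨rfl, rfl⟩ := hs'
      obtain ⟨w, hw, hvw⟩ := H.stored i
      have hinv : Function.invFun ι (ι w) = w := Function.leftInverse_invFun ι.injective w
      refine ⟨a, hr, H.nonneg, H.val, H.stored, H.done, fun p' => ?_⟩
      by_cases hpp : p' = p
      · subst hpp
        simp only [Function.update_self, hvw, hinv]
        refine ⟨hb, f, h1, ⟨j, z, h2, h3, fun hj => ?_⟩, fun k hk => ?_, fun hk => ?_⟩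
        · by_cases hji : j = i
          · subst hji
            have : z = w := ι.injective (h2.symm.trans hvw)
            simpa using this ▸ h3
          · simpa [hji] using h4 (by simpa [hji] using hj)
        · by_cases hki : k = i
          · subst hki
            simpa using ⟨hw, w, hvw, le_rfl⟩
          · simpa [hki] using h5 k (by simpa [hki] using hk)
        · by_cases hki : p' = i
          · subst hki
            simpa using hvw
          · simpa [hki] using h6 (by simpa [hki] using hk)
      · simpa [hpp] using H.proc p'
    | writeFence v ho =>
      cases hs with
      | fence m b p hb =>
        refine ⟨a, hr, H.nonneg, H.val, H.stored, H.done, fun p' => ?_⟩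
        by_cases hpp : p' = p
        · subst hpp
          simp only [Function.update_self]
          obtain ⟨k, h1, ⟨h2, _⟩ | ⟨_, h2⟩⟩ := h1
          · simp [hb] at h2
          · exact ⟨hb, k, h1, h2⟩
        · simpa [hpp] using H.proc p'
    | skipFence c v ho hv =>
      subst ho
      cases hs with
      | fence m b p hb =>
        obtain ⟨_, f, h1, ⟨j, z, h2, h3, h4⟩, h5, h6⟩ := h1
        obtain ⟨i, hi⟩ := exists_arrayMax_eq p c
        obtain ⟨hk, z', h7, h8⟩ := h5 i (by simp)
        rw [← hi] at hk h8
        refine ⟨_, hr.observe p _ f (arrayMax p c) h1 ((h4 (by simp)).trans (le_arrayMax p c j)) hk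
          (by rw [H.val _ hk]; exact max_eq_left (not_lt.1 hv)), H.nonneg, H.val, H.stored,
          H.done, fun p' => ?_⟩
        by_cases hpp : p' = p
        · subst hpp
          simp only [Function.update_self]
          exact ⟨hb, _, rfl, i, z', h7, h8⟩
        · simpa [hpp] using H.proc p'
    | write c v ho hv =>
      subst ho
      cases hs with
      | write m b p _ _ =>
        obtain ⟨hb, f, h1, ⟨j, z, h2, h3, h4⟩, h5, h6⟩ := h1
        simp only at hb
        have h6 := h6 (by simp)
        have hcp : c p < v := lt_of_le_of_lt (le_arrayMax p c p) hv
        have hfv : f < v := lt_of_le_of_lt ((h4 (by simp)).trans (le_arrayMax p c j)) hv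
        have hv0 : 0 ≤ v := (H.nonneg _ (h5 p (by simp)).1).trans hcp.le
        refine ⟨_, hr.effect p _ f v v .ack h1 hfv hv0 rfl (H.val v) ?_, ?_, ?_, fun i => ?_,
          H.done, fun p' => ?_⟩
        · rintro k hk s rfl
          exact ⟨max_eq_right hk, rfl⟩
        · rintro k (rfl | hk)
          · exact hv0
          · exact H.nonneg k hk
        · rintro k (rfl | hk)
          · simp
          · by_cases hkv : k = v
            · simp [hkv]
            · simpa [hkv] using H.val k hk
        · obtain ⟨w, h7, h8⟩ := H.stored i
          exact ⟨w, .inr h7, h8⟩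
        · by_cases hpp : p' = p
          · subst hpp
            simp only [Function.update_self, hb]
            exact ⟨v, rfl, .inl ⟨rfl, .inl rfl, c p', h6, hcp.le⟩⟩
          · have := (H.proc p').mono (Set.subset_insert v a.keys) (fun _ w hw => ⟨w, hw, le_rfl⟩) rfl
            simpa [hpp] using this
  · rintro q s h a p o y y' u hr H hq hy
    have h1 := H.proc p
    rw [hq] at h1
    cases hy with
    | respond u =>
      obtain ⟨hb, k, h1, h2⟩ := h1
      refine ⟨_, hr.res p u k h1, H.nonneg, H.val, H.stored, fun i => ?_, fun p' => ?_⟩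
      · rcases max_choice a.done k with h3 | h3 <;> simp only [h3]
        · exact H.done i
        · exact h2
      · by_cases hpp : p' = p
        · subst hpp
          simp only [Function.update_self]
          exact ⟨rfl, hb⟩
        · simpa [hpp] using H.proc p'
    | respondRead c ho =>
      subst ho
      obtain ⟨hb, f, h1, ⟨j, z, h2, h3, h4⟩, h5, h6⟩ := h1
      obtain ⟨i, hi⟩ := exists_arrayMax_eq p c
      obtain ⟨hk, z', h7, h8⟩ := h5 i (by simp)
      rw [← hi] at hk h8
      -- Without a closing fence the read commits and responds in one step of the implementation,
      -- which are two steps of the machine.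
      have hobs := hr.observe p _ f (arrayMax p c) h1 ((h4 (by simp)).trans (le_arrayMax p c j)) hk
        rfl
      rw [H.val _ hk] at hobs
      refine ⟨_, hobs.res p _ _ (Function.update_self ..), H.nonneg, H.val, H.stored, fun i' => ?_,
        fun p' => ?_⟩
      · rcases max_choice a.done (arrayMax p c) with h9 | h9 <;> simp only [h9]
        · exact H.done i'
        · exact ⟨i, z', h7, h8⟩
      · by_cases hpp : p' = p
        · subst hpp
          simp only [Function.update_self]
          exact ⟨rfl, hb⟩
        · simpa [hpp] using H.proc p'

end WMM

/-! ### The theorem, assembled from the four implementations. -/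

theorem mainTheorem12 (N : ℕ) (Var Val : Type) [DecidableEq Var] [Nonempty Var] [Zero Val] :
    -- registers
    (∀ A : Set Val,
      (∃ I : Impl (Fin N) Var Val (RegOp A) (RegRet Val),
        Linearizable (Reg (Fin N) A) I (TSO (Fin N) Var Val) ∧
        WaitFree I (TSO (Fin N) Var Val) ∧ FenceAfterWrite I) ∧
      (∃ I : Impl (Fin N) Var Val (RegOp A) (RegRet Val),
        Linearizable (Reg (Fin N) A) I (RA (Fin N) Var Val) ∧
        WaitFree I (RA (Fin N) Var Val) ∧ FenceAround I)) ∧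
    -- max-registers, when the memory has an array of `N` variables and can store integers
    (∀ (M : Fin N ↪ Var) (ι : ℤ ↪ Val), ι 0 = 0 →
      (∃ I : Impl (Fin N) Var Val (RegOp ℤ) (RegRet ℤ),
        Linearizable (MaxReg (Fin N)) I (TSO (Fin N) Var Val) ∧
        WaitFree I (TSO (Fin N) Var Val) ∧ FenceAfterWrite I) ∧
      (∃ I : Impl (Fin N) Var Val (RegOp ℤ) (RegRet ℤ),
        Linearizable (MaxReg (Fin N)) I (RA (Fin N) Var Val) ∧
        WaitFree I (RA (Fin N) Var Val) ∧ FenceAround I) ∧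
      (Linearizable (MaxReg (Fin N)) (collectMaxReg M ι) (RA (Fin N) Var Val) ∧
        WaitFree (collectMaxReg M ι) (RA (Fin N) Var Val) ∧ FenceAround (collectMaxReg M ι))) := by
  obtain ⟨x⟩ := ‹Nonempty Var›
  have : Nonempty Val := ⟨0⟩
  refine ⟨fun A => ⟨⟨plainReg (Fin N) A x, plainReg_linearizable A x,
    plainReg_waitFree A x tso_responsive, plainReg_fenceAfterWrite A x⟩,
    ⟨fencedReg (Fin N) A x, fencedReg_linearizable A x, fencedReg_waitFree A x ra_responsive,
    fencedReg_fenceAround A x⟩⟩, fun M ι hι => ?_⟩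
  have hcollect := And.intro (collectMaxReg_linearizable M ι hι)
    (And.intro (collectMaxReg_waitFree M ι (ra_responsive (P := Fin N)))
      (collectMaxReg_fenceAround M ι))
  exact ⟨⟨plainMaxReg M ι, plainMaxReg_linearizable M ι hι, plainMaxReg_waitFree M ι tso_responsive,
    plainMaxReg_fenceAfterWrite M ι⟩, ⟨_, hcollect⟩, hcollect⟩
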